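/- **Setting.** Let $G\rightrightarrows Q$ be a Lie groupoid with source $\alpha$, target $\beta$, identity section $\epsilon$, multiplication $m\colon G_2\to G$, $G_2=\{(g,h)\in G\times G\mid \beta(g)=\alpha(h)\}$, and inversion $i$: $G$ and $Q$ are finite-dimensional smooth manifolds without boundary, $\alpha,\beta$ are submersions, and all structural maps are smooth. Its Lie algebroid is, as a vector bundle, $\tau\colon AG\to Q$ with fibres $A_qG=\ker T_{\epsilon(q)}\alpha\subset T_{\epsilon(q)}G$; write $0_{AG}$ for its zero section. A *generalized discretization map* on $G$ is a smooth map $\mathcal R\colon AG\to G$ such that 1. $\mathcal R\circ 0_{AG}=\epsilon$, and 2. for all $q\in Q$ and $v_q\in A_qG$, with $\mathcal R_q=\mathcal R|_{A_qG}$ and the vertical lift $(v_q)^{\mathtt v}=\frac{d}{dt}\big|_{t=0}(t\,v_q)\in T_{0_{AG}(q)}(A_qG)$, $$T_{0_{AG}(q)}\mathcal R_q\big((v_q)^{\mathtt v}\big)=v_q+\big[T_q\epsilon\circ T_{\epsilon(q)}\alpha\circ T_{0_{AG}(q)}\mathcal R_q\big]\big((v_q)^{\mathtt v}\big).$$ The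 tangent maps $T\alpha,T\beta\colon TG\to TQ$, $T\epsilon$, $Ti$ and $Tm\colon T(G_2)\to TG$, where $T(G_2)=\{(X,Y)\in TG\times TG\mid T\beta(X)=T\alpha(Y)\}$, are the structural maps of the *tangent groupoid* $TG\rightrightarrows TQ$. **Theorem.** Let $\mathcal R\colon AG\to G$ be a generalized discretization map on $G\rightrightarrows Q$. Then $TG\rightrightarrows TQ$ is a Lie groupoid. The canonical involution $\kappa_G$ of $T(TG)$ restricts to a diffeomorphism $J$ from $T(AG)\subset T(TG)$ onto the Lie algebroid $A(TG)$ of $TG\rightrightarrows TQ$; it covers the identity of $TQ$ and is linear on the fibres, so that it is an isomorphism of vector bundles over $TQ$ from $T\tau\colon T(AG)\to TQ$ (whose addition and scalar multiplication are the tangent maps of those of $AG$) to $A(TG)\to TQ$. With $T(AG)$ identified with $A(TG)$ by $J$, the tangent map $T\mathcal R\colon T(AG)\to TG$ is a generalized discretization map on the tangent Lie groupoid, i.e. $T\mathcal R\circ J^{-1}\colon A(TG)\to TG$ is a generalized discretization map on $TG\rightrightarrows TQ$. -/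

import Mathlib

open Manifold Bundle Set Topology
open scoped ContDiff

noncomputable section LieGroupoidDefs

set_option linter.unusedSectionVars false

variable {EG HG G EQ HQ Q : Type*}
  [NormedAddCommGroup EG] [NormedSpace ℝ EG] [TopologicalSpace HG]
  [NormedAddCommGroup EQ] [NormedSpace ℝ EQ] [TopologicalSpace HQ]
  [TopologicalSpace G] [ChartedSpace HG G] [TopologicalSpace Q] [ChartedSpace HQ Q]

/-- The structural maps of a groupoid `G ⇉ Q`. Arrows are composed as in `g h : x → z` for
`g : x → y` and `h : y → z`; only the values `mul g h` with `target g = source h` are meaningful. -/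
structure GroupoidData (G Q : Type*) where
  source : G → Q
  target : G → Q
  unit : Q → G
  mul : G → G → G
  inv : G → G

namespace GroupoidData

/-- The set `G₂ ⊆ G × G` of composable pairs. -/
def composable (D : GroupoidData G Q) : Set (G × G) := {p | D.target p.1 = D.source p.2}

/-- `G ⇉ Q` is a Lie groupoid: the groupoid axioms hold, source and target are submersions, and all
structural maps are smooth. Since source and target are submersions, `G₂` is an embedded submanifold
of `G × G`, and smoothness of the multiplication on this submanifold is `ContMDiffOn`. -/
structure IsLieGroupoid (IG : ModelWithCorners ℝ EG HG) (IQ : ModelWithCorners ℝ EQ HQ)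
    (D : GroupoidData G Q) : Prop where
  source_unit : ∀ q, D.source (D.unit q) = q
  target_unit : ∀ q, D.target (D.unit q) = q
  source_mul : ∀ g h, D.target g = D.source h → D.source (D.mul g h) = D.source g
  target_mul : ∀ g h, D.target g = D.source h → D.target (D.mul g h) = D.target h
  mul_assoc : ∀ g h k, D.target g = D.source h → D.target h = D.source k →
    D.mul (D.mul g h) k = D.mul g (D.mul h k)
  unit_mul : ∀ g, D.mul (D.unit (D.source g)) g = g
  mul_unit : ∀ g, D.mul g (D.unit (D.target g)) = g
  source_inv : ∀ g, D.source (D.inv g) = D.target g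
  target_inv : ∀ g, D.target (D.inv g) = D.source g
  inv_mul : ∀ g, D.mul (D.inv g) g = D.unit (D.target g)
  mul_inv : ∀ g, D.mul g (D.inv g) = D.unit (D.source g)
  isSubmersion_source : Manifold.IsSubmersion IG IQ ∞ D.source
  isSubmersion_target : Manifold.IsSubmersion IG IQ ∞ D.target
  contMDiff_source : ContMDiff IG IQ ∞ D.source
  contMDiff_target : ContMDiff IG IQ ∞ D.target
  contMDiff_unit : ContMDiff IQ IG ∞ D.unit
  contMDiff_inv : ContMDiff IG IG ∞ D.inv
  contMDiffOn_mul : ContMDiffOn (IG.prod IG) IG ∞ (fun p : G × G => D.mul p.1 p.2) D.composable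

/-- The structural maps of the tangent groupoid `TG ⇉ TQ`: the tangent maps of those of `G ⇉ Q`.
The multiplication is the tangent map of `m : G₂ → G`. A pair `(X, Y)` with `Tβ X = Tα Y` is a
tangent vector to the submanifold `G₂ ⊆ G × G`, and on such vectors every derivative of `m` within
`G₂` takes the same value, so that the choice made by `mfderivWithin` does not matter. -/
def tangent (IG : ModelWithCorners ℝ EG HG) (IQ : ModelWithCorners ℝ EQ HQ)
    (D : GroupoidData G Q) : GroupoidData (TangentBundle IG G) (TangentBundle IQ Q) where
  source := tangentMap IG IQ D.source
  target := tangentMap IG IQ D.target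
  unit := tangentMap IQ IG D.unit
  mul X Y := ⟨D.mul X.1 Y.1,
    mfderivWithin (IG.prod IG) IG (fun p : G × G => D.mul p.1 p.2) D.composable (X.1, Y.1)
      (X.2, Y.2)⟩
  inv := tangentMap IG IG D.inv

end GroupoidData

variable {IG : ModelWithCorners ℝ EG HG} {IQ : ModelWithCorners ℝ EQ HQ}
  [IG.Boundaryless] [IQ.Boundaryless] [IsManifold IG ∞ G] [IsManifold IQ ∞ Q]
  [FiniteDimensional ℝ EG] [FiniteDimensional ℝ EQ]

/-- The model fibre `ℝ^r` of the Lie algebroid, where `r = dim G - dim Q`. -/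
abbrev AlgebroidModelFiber (EG EQ : Type*) [NormedAddCommGroup EG] [NormedSpace ℝ EG]
    [NormedAddCommGroup EQ] [NormedSpace ℝ EQ] : Type :=
  EuclideanSpace ℝ (Fin (Module.finrank ℝ EG - Module.finrank ℝ EQ))

namespace GroupoidData

theorem IsLieGroupoid.mfderiv_source_comp {D : GroupoidData G Q} (h : D.IsLieGroupoid IG IQ) (q : Q) 
    (w : EQ) : 
    (mfderiv IG IQ D.source (D.unit q) (mfderiv IQ IG D.unit q w) : EQ) = w := by
  have h1 : HasMFDerivAt IQ IG D.unit q (mfderiv IQ IG D.unit q) :=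
    ((h.contMDiff_unit q).mdifferentiableAt (by simp)).hasMFDerivAt
  have h2 : HasMFDerivAt IG IQ D.source (D.unit q) (mfderiv IG IQ D.source (D.unit q)) :=
    ((h.contMDiff_source _).mdifferentiableAt (by simp)).hasMFDerivAt
  have h3 := h2.comp q h1
  have h4 : D.source ∘ D.unit = id := funext h.source_unit
  rw [h4] at h3
  have := hasMFDerivAt_unique h3 (hasMFDerivAt_id q)
  exact DFunLike.congr_fun this w

/-- The differential of the source map at `ε(q)`, read in the preferred charts at `ε(q₀)` and `q₀`. -/
def coordDeriv (IG : ModelWithCorners ℝ EG HG) (IQ : ModelWithCorners ℝ EQ HQ)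
    (D : GroupoidData G Q) (q₀ q : Q) : EG →L[ℝ] EQ :=
  fderiv ℝ (extChartAt IQ q₀ ∘ D.source ∘ (extChartAt IG (D.unit q₀)).symm)
    (extChartAt IG (D.unit q₀) (D.unit q))

/-- The points `q` for which `ε(q)` and `q` lie in the preferred charts at `ε(q₀)` and `q₀`. -/
def coordSet (HG HQ : Type*) [TopologicalSpace HG] [TopologicalSpace HQ] [ChartedSpace HG G]
    [ChartedSpace HQ Q] (D : GroupoidData G Q) (q₀ : Q) : Set Q :=
  {q | D.unit q ∈ (chartAt HG (D.unit q₀)).source ∧ q ∈ (chartAt HQ q₀).source}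

theorem IsLieGroupoid.contDiffAt_coord {D : GroupoidData G Q} (h : D.IsLieGroupoid IG IQ) {q₀ q : Q}
    (hq : q ∈ D.coordSet HG HQ q₀) :
    ContDiffAt ℝ ∞ (extChartAt IQ q₀ ∘ D.source ∘ (extChartAt IG (D.unit q₀)).symm)
      (extChartAt IG (D.unit q₀) (D.unit q)) := by
  have hq1 : D.unit q ∈ (extChartAt IG (D.unit q₀)).source := by
    rw [extChartAt_source]; exact hq.1
  have hq2 : q ∈ (extChartAt IQ q₀).source := by rw [extChartAt_source]; exact hq.2
  rw [← contMDiffAt_iff_contDiffAt]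
  have h1 : ContMDiffAt 𝓘(ℝ, EG) IG ∞ (extChartAt IG (D.unit q₀)).symm
      (extChartAt IG (D.unit q₀) (D.unit q)) := by
    have := contMDiffWithinAt_extChartAt_symm_range (I := IG) (n := ∞) (D.unit q₀)
      ((extChartAt IG (D.unit q₀)).map_source hq1)
    rwa [IG.range_eq_univ, contMDiffWithinAt_univ] at this
  have h2 : (extChartAt IG (D.unit q₀)).symm (extChartAt IG (D.unit q₀) (D.unit q)) = D.unit q :=
    (extChartAt IG (D.unit q₀)).left_inv hq1
  refine ContMDiffAt.comp _ ?_ (ContMDiffAt.comp _ (h.contMDiff_source _) h1)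
  simp only [Function.comp_apply, h2, h.source_unit]
  exact contMDiffAt_extChartAt' hq.2

theorem IsLieGroupoid.coordDeriv_comp {D : GroupoidData G Q} (h : D.IsLieGroupoid IG IQ) {q₀ q : Q}
    (hq : q ∈ D.coordSet HG HQ q₀) (v : TangentSpace IG (D.unit q)) :
    D.coordDeriv IG IQ q₀ q (mfderiv IG 𝓘(ℝ, EG) (extChartAt IG (D.unit q₀)) (D.unit q) v) =
      mfderiv IQ 𝓘(ℝ, EQ) (extChartAt IQ q₀) (D.source (D.unit q))
        (mfderiv IG IQ D.source (D.unit q) v) := by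
  have hq1 : D.unit q ∈ (extChartAt IG (D.unit q₀)).source := by
    rw [extChartAt_source]; exact hq.1
  have hd := (h.contDiffAt_coord hq).differentiableAt (by simp)
  have h1 : HasMFDerivAt IG 𝓘(ℝ, EG) (extChartAt IG (D.unit q₀)) (D.unit q) _ :=
    (mdifferentiableAt_extChartAt hq.1).hasMFDerivAt
  have h2 := hd.hasFDerivAt.hasMFDerivAt.comp (D.unit q) h1
  have h3 : HasMFDerivAt IG IQ D.source (D.unit q) _ :=
    ((h.contMDiff_source _).mdifferentiableAt (by simp)).hasMFDerivAt
  have h4 : HasMFDerivAt IQ 𝓘(ℝ, EQ) (extChartAt IQ q₀) (D.source (D.unit q)) _ :=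
    (mdifferentiableAt_extChartAt (by rw [h.source_unit]; exact hq.2)).hasMFDerivAt
  have h5 := h4.comp (D.unit q) h3
  have h6 : (extChartAt IQ q₀ ∘ D.source ∘ (extChartAt IG (D.unit q₀)).symm) ∘
      (extChartAt IG (D.unit q₀)) =ᶠ[𝓝 (D.unit q)] extChartAt IQ q₀ ∘ D.source := by
    filter_upwards [extChartAt_source_mem_nhds' hq1] with g hg
    simp only [Function.comp_apply]
    rw [(extChartAt IG (D.unit q₀)).left_inv hg]
  have h7 := hasMFDerivAt_unique (h5.congr_of_eventuallyEq h6) h2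
  exact (DFunLike.congr_fun h7 v).symm

theorem IsLieGroupoid.contMDiffOn_coordDeriv {D : GroupoidData G Q} (h : D.IsLieGroupoid IG IQ)
    (q₀ : Q) :
    ContMDiffOn IQ 𝓘(ℝ, EG →L[ℝ] EQ) ∞ (D.coordDeriv IG IQ q₀) (D.coordSet HG HQ q₀) := by
  intro q hq
  have h1 : ContDiffAt ℝ ∞ (fderiv ℝ (extChartAt IQ q₀ ∘ D.source ∘
      (extChartAt IG (D.unit q₀)).symm)) (extChartAt IG (D.unit q₀) (D.unit q)) :=
    (h.contDiffAt_coord hq).fderiv_right (by simp)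
  have h2 : ContMDiffAt IQ 𝓘(ℝ, EG) ∞ (fun q => extChartAt IG (D.unit q₀) (D.unit q)) q :=
    ContMDiffAt.comp q (contMDiffAt_extChartAt' hq.1) (h.contMDiff_unit q)
  exact (h1.contMDiffAt.comp q h2).contMDiffWithinAt

theorem IsLieGroupoid.isOpen_coordSet {D : GroupoidData G Q} (h : D.IsLieGroupoid IG IQ) (q₀ : Q) :
    IsOpen (D.coordSet HG HQ q₀) :=
  ((chartAt HG (D.unit q₀)).open_source.preimage h.contMDiff_unit.continuous).inter
    (chartAt HQ q₀).open_source

theorem IsLieGroupoid.exists_compl {D : GroupoidData G Q} (h : D.IsLieGroupoid IG IQ) (q₀ : Q) :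
    ∃ L : EG →L[ℝ] AlgebroidModelFiber EG EQ, ((D.coordDeriv IG IQ q₀ q₀).prod L).IsInvertible := by
  have hq₀ : q₀ ∈ D.coordSet HG HQ q₀ := ⟨mem_chart_source _ _, mem_chart_source _ _⟩
  have hsurj : Function.Surjective (D.coordDeriv IG IQ q₀ q₀) := by
    intro w
    have hi : (mfderiv IQ 𝓘(ℝ, EQ) (extChartAt IQ q₀) (D.source (D.unit q₀))).IsInvertible :=
      isInvertible_mfderiv_extChartAt (by rw [h.source_unit]; exact mem_extChartAt_source q₀)
    obtain ⟨w', hw'⟩ := hi.bijective.surjective w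
    refine ⟨_, (h.coordDeriv_comp hq₀ (mfderiv IQ IG D.unit q₀ w')).trans ?_⟩
    rw [← hw']
    congr 1
    exact h.mfderiv_source_comp q₀ w'
  set A : EG →ₗ[ℝ] EQ := (D.coordDeriv IG IQ q₀ q₀ : EG →ₗ[ℝ] EQ) with hA
  have hrank := A.finrank_range_add_finrank_ker
  rw [LinearMap.range_eq_top.2 hsurj, finrank_top] at hrank
  have hk : Module.finrank ℝ (LinearMap.ker A) = Module.finrank ℝ (AlgebroidModelFiber EG EQ) := by
    rw [finrank_euclideanSpace_fin]; omega
  let Ψ := LinearEquiv.ofFinrankEq _ _ hk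
  obtain ⟨L, hL⟩ := Ψ.toLinearMap.exists_extend
  refine ⟨L.toContinuousLinearMap, ?_⟩
  have hinj : Function.Injective (A.prod L) := by
    rw [← LinearMap.ker_eq_bot, LinearMap.ker_eq_bot']
    intro v hv
    have hv1 : A v = 0 := congrArg Prod.fst hv
    have hv2 : L v = 0 := congrArg Prod.snd hv
    have h3 := LinearMap.congr_fun hL ⟨v, hv1⟩
    simp only [LinearMap.comp_apply, Submodule.subtype_apply, hv2, LinearEquiv.coe_coe] at h3
    have h4 := (LinearEquiv.map_eq_zero_iff Ψ).1 h3.symm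
    simpa using congrArg Subtype.val h4
  have hd : Module.finrank ℝ EG = Module.finrank ℝ (EQ × AlgebroidModelFiber EG EQ) := by
    rw [Module.finrank_prod, ← hk]; omega
  refine ⟨(LinearEquiv.ofInjectiveOfFinrankEq (A.prod L) hinj hd).toContinuousLinearEquiv, ?_⟩
  ext v <;> rfl


/-- The fibre `A_q G = ker (T_{ε(q)} α)` of the Lie algebroid of `G ⇉ Q`. -/
def Algebroid {D : GroupoidData G Q} (_h : D.IsLieGroupoid IG IQ) (q : Q) : Type _ :=
  LinearMap.ker (mfderiv IG IQ D.source (D.unit q)).toLinearMap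

instance {D : GroupoidData G Q} (h : D.IsLieGroupoid IG IQ) (q : Q) : AddCommGroup (Algebroid h q) :=
  inferInstanceAs (AddCommGroup (LinearMap.ker (mfderiv IG IQ D.source (D.unit q)).toLinearMap))
instance {D : GroupoidData G Q} (h : D.IsLieGroupoid IG IQ) (q : Q) : Module ℝ (Algebroid h q) :=
  inferInstanceAs (Module ℝ (LinearMap.ker (mfderiv IG IQ D.source (D.unit q)).toLinearMap))
instance {D : GroupoidData G Q} (h : D.IsLieGroupoid IG IQ) (q : Q) :
    TopologicalSpace (Algebroid h q) :=
  inferInstanceAs (TopologicalSpace (LinearMap.ker (mfderiv IG IQ D.source (D.unit q)).toLinearMap))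

/-- The inclusion of `A_q G` into `T_{ε(q)} G`. -/
def Algebroid.toTangent {D : GroupoidData G Q} (h : D.IsLieGroupoid IG IQ) (q : Q) :
    Algebroid h q →ₗ[ℝ] TangentSpace IG (D.unit q) :=
  Submodule.subtype (LinearMap.ker (mfderiv IG IQ D.source (D.unit q)).toLinearMap)

/-- A vector of `T_{ε(q)} G` that is killed by `T_{ε(q)} α`, as an element of `A_q G`. -/
def Algebroid.mk {D : GroupoidData G Q} (h : D.IsLieGroupoid IG IQ) (q : Q)
    (v : TangentSpace IG (D.unit q)) (hv : mfderiv IG IQ D.source (D.unit q) v = 0) :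
    Algebroid h q :=
  (⟨v, hv⟩ : LinearMap.ker (mfderiv IG IQ D.source (D.unit q)).toLinearMap)

theorem Algebroid.toTangent_mk {D : GroupoidData G Q} (h : D.IsLieGroupoid IG IQ) (q : Q)
    (v : TangentSpace IG (D.unit q)) (hv : mfderiv IG IQ D.source (D.unit q) v = 0) :
    Algebroid.toTangent h q (Algebroid.mk h q v hv) = v := rfl

theorem Algebroid.toTangent_injective {D : GroupoidData G Q} (h : D.IsLieGroupoid IG IQ) (q : Q) :
    Function.Injective (Algebroid.toTangent h q) := Subtype.val_injective

theorem Algebroid.mfderiv_toTangent {D : GroupoidData G Q} (h : D.IsLieGroupoid IG IQ) (q : Q)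
    (v : Algebroid h q) :
    mfderiv IG IQ D.source (D.unit q) (Algebroid.toTangent h q v) = 0 := v.2

theorem Algebroid.isInducing_toTangent {D : GroupoidData G Q} (h : D.IsLieGroupoid IG IQ) (q : Q) :
    IsInducing (Algebroid.toTangent h q) := IsInducing.subtypeVal

namespace IsLieGroupoid
variable {D : GroupoidData G Q} (h : D.IsLieGroupoid IG IQ)

/-- A linear map `T_{ε(q₀)} G → ℝ^r` that is an isomorphism on `A_{q₀} G`. -/
def compl (q₀ : Q) : EG →L[ℝ] AlgebroidModelFiber EG EQ := (h.exists_compl q₀).choose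

/-- The map `(Tα, compl)` at `ε(q)` in coordinates. -/
def frame (q₀ q : Q) : EG →L[ℝ] EQ × AlgebroidModelFiber EG EQ :=
  (D.coordDeriv IG IQ q₀ q).prod (compl h q₀)

/-- The open set over which `compl` in the chart at `ε(q₀)` trivializes the bundle `AG`. -/
def trivSet (q₀ : Q) : Set Q := {q | q ∈ D.coordSet HG HQ q₀ ∧ (frame h q₀ q).IsInvertible}

theorem mem_trivSet (q₀ : Q) : q₀ ∈ trivSet h q₀ :=
  ⟨⟨mem_chart_source _ _, mem_chart_source _ _⟩, (h.exists_compl q₀).choose_spec⟩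

theorem contMDiffOn_frame (q₀ : Q) :
    ContMDiffOn IQ 𝓘(ℝ, EG →L[ℝ] EQ × AlgebroidModelFiber EG EQ) ∞ (frame h q₀) (D.coordSet HG HQ q₀) := by
  have h1 : frame h q₀ = fun q => ContinuousLinearMap.inl ℝ EQ (AlgebroidModelFiber EG EQ) ∘L
      D.coordDeriv IG IQ q₀ q + ContinuousLinearMap.inr ℝ EQ (AlgebroidModelFiber EG EQ) ∘L compl h q₀ := by
    funext q
    ext v <;> simp [frame]
  rw [h1]
  exact (contMDiffOn_const.clm_comp (h.contMDiffOn_coordDeriv q₀)).add contMDiffOn_const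

theorem isOpen_trivSet (q₀ : Q) : IsOpen (trivSet h q₀) := by
  have h1 := (contMDiffOn_frame h q₀).continuousOn.isOpen_inter_preimage (h.isOpen_coordSet q₀)
    (ContinuousLinearEquiv.isOpen (𝕜 := ℝ) (E := EG) (F := EQ × AlgebroidModelFiber EG EQ))
  exact h1

/-- The differential at `ε(q)` of the preferred chart at `ε(q₀)`. -/
abbrev chartDeriv {D : GroupoidData G Q} (_h : D.IsLieGroupoid IG IQ) (q₀ q : Q) :
    TangentSpace IG (D.unit q) →L[ℝ] EG :=
  mfderiv IG 𝓘(ℝ, EG) (extChartAt IG (D.unit q₀)) (D.unit q)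

theorem isInvertible_chartDeriv {q₀ q : Q} (hq : q ∈ trivSet h q₀) :
    (chartDeriv h q₀ q).IsInvertible :=
  isInvertible_mfderiv_extChartAt (by rw [extChartAt_source]; exact hq.1.1)

/-- The vector of `A_q G` with coordinate `f`, as a tangent vector of `G`. -/
def vec (q₀ q : Q) (f : AlgebroidModelFiber EG EQ) : TangentSpace IG (D.unit q) :=
  (chartDeriv h q₀ q).inverse ((frame h q₀ q).inverse (0, f))

theorem frame_chartDeriv {q₀ q : Q} (hq : q ∈ trivSet h q₀) (v : TangentSpace IG (D.unit q))
    (hv : mfderiv IG IQ D.source (D.unit q) v = 0) :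
    frame h q₀ q (chartDeriv h q₀ q v) = (0, compl h q₀ (chartDeriv h q₀ q v)) := by
  refine Prod.ext ?_ rfl
  refine (h.coordDeriv_comp hq.1 v).trans ?_
  rw [hv]
  exact map_zero _

theorem vec_mem {q₀ q : Q} (hq : q ∈ trivSet h q₀) (f : AlgebroidModelFiber EG EQ) :
    mfderiv IG IQ D.source (D.unit q) (vec h q₀ q f) = 0 := by
  have h1 : chartDeriv h q₀ q (vec h q₀ q f) = (frame h q₀ q).inverse (0, f) :=
    (isInvertible_chartDeriv h hq).self_apply_inverse _
  have h2 : D.coordDeriv IG IQ q₀ q (chartDeriv h q₀ q (vec h q₀ q f)) = 0 := by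
    rw [h1]
    exact congrArg Prod.fst (hq.2.self_apply_inverse (0, f))
  have h3 := (h.coordDeriv_comp hq.1 (vec h q₀ q f)).symm.trans h2
  have hi : (mfderiv IQ 𝓘(ℝ, EQ) (extChartAt IQ q₀) (D.source (D.unit q))).IsInvertible :=
    isInvertible_mfderiv_extChartAt
      (by rw [h.source_unit, extChartAt_source]; exact hq.1.2)
  exact hi.injective (h3.trans (map_zero _).symm)

theorem compl_vec {q₀ q : Q} (hq : q ∈ trivSet h q₀) (f : AlgebroidModelFiber EG EQ) :
    compl h q₀ (chartDeriv h q₀ q (vec h q₀ q f)) = f := by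
  have h1 : chartDeriv h q₀ q (vec h q₀ q f) = (frame h q₀ q).inverse (0, f) :=
    (isInvertible_chartDeriv h hq).self_apply_inverse _
  rw [h1]
  exact congrArg Prod.snd (hq.2.self_apply_inverse (0, f))

theorem vec_compl {q₀ q : Q} (hq : q ∈ trivSet h q₀) (v : TangentSpace IG (D.unit q))
    (hv : mfderiv IG IQ D.source (D.unit q) v = 0) :
    vec h q₀ q (compl h q₀ (chartDeriv h q₀ q v)) = v := by
  rw [vec, ← frame_chartDeriv h hq v hv, hq.2.inverse_apply_self]
  exact (isInvertible_chartDeriv h hq).inverse_apply_self v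


open Classical in
/-- The vector of `A_q G` with coordinate `f`. -/
def ofCoord (q₀ q : Q) (f : AlgebroidModelFiber EG EQ) : Algebroid h q :=
  if hq : q ∈ trivSet h q₀ then Algebroid.mk h q (vec h q₀ q f) (vec_mem h hq f) else 0

theorem toTangent_ofCoord {q₀ q : Q} (hq : q ∈ trivSet h q₀) (f : AlgebroidModelFiber EG EQ) :
    Algebroid.toTangent h q (ofCoord h q₀ q f) = vec h q₀ q f := by
  rw [ofCoord, dif_pos hq, Algebroid.toTangent_mk]

/-- The local trivialization of `AG` around `q₀`: a vector `v` tangent to the source fibre at `ε(q)`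
is sent to `compl` of its coordinates in the chart at `ε(q₀)`. -/
def pretriv (q₀ : Q) :
    Pretrivialization (AlgebroidModelFiber EG EQ) (π (AlgebroidModelFiber EG EQ) (Algebroid h)) where
  toFun p := (p.1, compl h q₀ (chartDeriv h q₀ p.1 (Algebroid.toTangent h p.1 p.2)))
  invFun p := ⟨p.1, ofCoord h q₀ p.1 p.2⟩
  source := π (AlgebroidModelFiber EG EQ) (Algebroid h) ⁻¹' trivSet h q₀
  target := trivSet h q₀ ×ˢ univ
  map_source' p hp := ⟨hp, mem_univ _⟩
  map_target' p hp := hp.1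
  left_inv' := by
    rintro ⟨q, v⟩ hq
    simp only [TotalSpace.mk_inj]
    apply Algebroid.toTangent_injective h q
    rw [toTangent_ofCoord h hq]
    exact vec_compl h hq _ (Algebroid.mfderiv_toTangent h q v)
  right_inv' := by
    rintro ⟨q, f⟩ ⟨hq, -⟩
    refine Prod.ext rfl ?_
    simp only
    rw [toTangent_ofCoord h hq]
    exact compl_vec h hq f
  open_target := (isOpen_trivSet h q₀).prod isOpen_univ
  baseSet := trivSet h q₀
  open_baseSet := isOpen_trivSet h q₀
  source_eq := rfl
  target_eq := rfl
  proj_toFun _ _ := rfl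

theorem pretriv_symm {q₀ q : Q} (hq : q ∈ trivSet h q₀) (f : AlgebroidModelFiber EG EQ) :
    (pretriv h q₀).symm q f = ofCoord h q₀ q f := by
  have hq' : q ∈ (pretriv h q₀).baseSet := hq
  rw [Pretrivialization.symm_apply _ hq']
  rfl

theorem exists_coordChange (i j : Q) : ∃ f : Q → AlgebroidModelFiber EG EQ →L[ℝ] AlgebroidModelFiber EG EQ,
    ContMDiffOn IQ 𝓘(ℝ, AlgebroidModelFiber EG EQ →L[ℝ] AlgebroidModelFiber EG EQ) ∞ f (trivSet h i ∩ trivSet h j) ∧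
    ∀ q ∈ trivSet h i ∩ trivSet h j, ∀ v, f q v = (pretriv h j ⟨q, (pretriv h i).symm q v⟩).2 := by
  let e (i : Q) := trivializationAt EG (TangentSpace IG) (D.unit i)
  refine ⟨fun q => compl h j ∘L (((e i).coordChangeL ℝ (e j) (D.unit q) : EG →L[ℝ] EG) ∘L
    ((frame h i q).inverse ∘L ContinuousLinearMap.inr ℝ EQ (AlgebroidModelFiber EG EQ))), ?_, ?_⟩
  · intro q hq
    have h1 : ContMDiffWithinAt IQ 𝓘(ℝ, EQ × AlgebroidModelFiber EG EQ →L[ℝ] EG) ∞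
        (fun q => (frame h i q).inverse) (trivSet h i ∩ trivSet h j) q :=
      ((hq.1.2.contDiffAt_map_inverse (n := ∞)).contMDiffAt.comp_contMDiffWithinAt q
        ((contMDiffOn_frame h i).mono (fun q hq => hq.1.1) q hq))
    have h2 : ContMDiffWithinAt IQ 𝓘(ℝ, EG →L[ℝ] EG) ∞
        (fun q => ((e i).coordChangeL ℝ (e j) (D.unit q) : EG →L[ℝ] EG))
        (trivSet h i ∩ trivSet h j) q :=
      ((contMDiffAt_coordChangeL (IB := IG) (n := ∞) (e := e i) (e' := e j) (x := D.unit q)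
        hq.1.1.1 hq.2.1.1).comp q (h.contMDiff_unit q)).contMDiffWithinAt
    exact contMDiffWithinAt_const.clm_comp (h2.clm_comp (h1.clm_comp contMDiffWithinAt_const))
  · intro q hq v
    rw [pretriv_symm h hq.1]
    change compl h j ((e i).coordChangeL ℝ (e j) (D.unit q) ((frame h i q).inverse (0, v))) =
      compl h j (chartDeriv h j q (Algebroid.toTangent h q (ofCoord h i q v)))
    rw [toTangent_ofCoord h hq.1]
    congr 1
    have hi : D.unit q ∈ (e i).baseSet := hq.1.1.1
    have hj : D.unit q ∈ (e j).baseSet := hq.2.1.1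
    have h1 : chartDeriv h i q (vec h i q v) = (frame h i q).inverse (0, v) :=
      (isInvertible_chartDeriv h hq.1).self_apply_inverse _
    have h2 : (e i).continuousLinearMapAt ℝ (D.unit q) = chartDeriv h i q :=
      TangentBundle.continuousLinearMapAt_trivializationAt hq.1.1.1
    have h3 : (e j).continuousLinearMapAt ℝ (D.unit q) = chartDeriv h j q :=
      TangentBundle.continuousLinearMapAt_trivializationAt hq.2.1.1
    rw [← h1, ← h2, ← h3, Trivialization.coordChangeL_apply _ _ ⟨hi, hj⟩,
      ← Trivialization.symmL_apply (R := ℝ) _ hi,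
      Trivialization.symmL_continuousLinearMapAt _ hi,
      Trivialization.continuousLinearMapAt_apply, Trivialization.coe_linearMapAt_of_mem _ hj]

/-- The vector bundle structure of `τ : AG → Q`. -/
def prebundle : VectorPrebundle ℝ (AlgebroidModelFiber EG EQ) (Algebroid h) where
  pretrivializationAtlas := range (pretriv h)
  pretrivialization_linear' := by
    rintro _ ⟨q₀, rfl⟩
    refine ⟨fun q _ => ⟨fun v w => ?_, fun c v => ?_⟩⟩
    · change compl h q₀ (chartDeriv h q₀ q (Algebroid.toTangent h q (v + w))) =
        compl h q₀ (chartDeriv h q₀ q (Algebroid.toTangent h q v)) +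
        compl h q₀ (chartDeriv h q₀ q (Algebroid.toTangent h q w))
      simp only [map_add]
    · change compl h q₀ (chartDeriv h q₀ q (Algebroid.toTangent h q (c • v))) =
        c • compl h q₀ (chartDeriv h q₀ q (Algebroid.toTangent h q v))
      simp only [map_smul]
  pretrivializationAt := pretriv h
  mem_base_pretrivializationAt := mem_trivSet h
  pretrivialization_mem_atlas q := ⟨q, rfl⟩
  exists_coordChange := by
    rintro _ ⟨i, rfl⟩ _ ⟨j, rfl⟩
    obtain ⟨f, hf1, hf2⟩ := exists_coordChange h i j
    exact ⟨f, hf1.continuousOn, hf2⟩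
  totalSpaceMk_isInducing q := by
    have hi := isInvertible_chartDeriv h (mem_trivSet h q)
    obtain ⟨e, he⟩ := (mem_trivSet h q).2
    obtain ⟨e', he'⟩ := hi
    have h1 : IsInducing fun v : Algebroid h q =>
        e (e' (Algebroid.toTangent h q v)) :=
      (e.toHomeomorph.isInducing.comp e'.toHomeomorph.isInducing).comp
        (Algebroid.isInducing_toTangent h q)
    have h2 : (fun v : Algebroid h q => e (e' (Algebroid.toTangent h q v))) =
        Prod.mk (0 : EQ) ∘ fun v : Algebroid h q =>
          compl h q (chartDeriv h q q (Algebroid.toTangent h q v)) := by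
      funext v
      have := frame_chartDeriv h (mem_trivSet h q) _ (Algebroid.mfderiv_toTangent h q v)
      rw [Function.comp_apply, ← this, ← he, ← he']
      rfl
    rw [h2] at h1
    have h3 : IsInducing fun v : Algebroid h q =>
          compl h q (chartDeriv h q q (Algebroid.toTangent h q v)) :=
      isInducing_const_prod.1 h1
    exact isInducing_const_prod.2 h3

/- `AG` is a smooth vector bundle over `Q`, so that its total space is a smooth manifold. -/

instance : TopologicalSpace (TotalSpace (AlgebroidModelFiber EG EQ) (Algebroid h)) :=
  (prebundle h).totalSpaceTopology

instance : FiberBundle (AlgebroidModelFiber EG EQ) (Algebroid h) := (prebundle h).toFiberBundle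

instance : VectorBundle ℝ (AlgebroidModelFiber EG EQ) (Algebroid h) := (prebundle h).toVectorBundle

instance : (prebundle h).IsContMDiff IQ ∞ where
  exists_contMDiffCoordChange := by
    rintro _ ⟨i, rfl⟩ _ ⟨j, rfl⟩
    exact exists_coordChange h i j

instance : ContMDiffVectorBundle ∞ (AlgebroidModelFiber EG EQ) (Algebroid h) IQ :=
  (prebundle h).contMDiffVectorBundle IQ

end IsLieGroupoid

end GroupoidData

namespace GroupoidData.IsLieGroupoid

variable {D : GroupoidData G Q} (h : D.IsLieGroupoid IG IQ)

/-- The total space of the Lie algebroid `τ : AG → Q`, a manifold modelled on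
`IQ.prod 𝓘(ℝ, AlgebroidModelFiber EG EQ)`. -/
abbrev AlgebroidSpace : Type _ := TotalSpace (AlgebroidModelFiber EG EQ) (Algebroid h)

/-- The inclusion `AG → TG`. -/
def inclusion (p : h.AlgebroidSpace) : TangentBundle IG G :=
  ⟨D.unit p.1, Algebroid.toTangent h p.1 p.2⟩

/-- The inclusion `AG → TG` is smooth for the manifold structure of `AG`. -/
theorem contMDiff_inclusion :
    ContMDiff (IQ.prod 𝓘(ℝ, AlgebroidModelFiber EG EQ)) IG.tangent ∞ h.inclusion := by
  intro p
  rw [contMDiffAt_totalSpace]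
  have hp : ContMDiffAt (IQ.prod 𝓘(ℝ, AlgebroidModelFiber EG EQ)) IQ ∞
    (π (AlgebroidModelFiber EG EQ) (Algebroid h)) p := contMDiffAt_proj _
  refine ⟨(h.contMDiff_unit _).comp p hp, ?_⟩
  have hid := (contMDiffAt_totalSpace (IB := IQ) (n := ∞) (F := AlgebroidModelFiber EG EQ) (E := Algebroid h)
    (f := id) (x₀ := p) (IM := IQ.prod 𝓘(ℝ, AlgebroidModelFiber EG EQ))).1 contMDiffAt_id
  have hm := h.mem_trivSet p.1
  have h1 : ContMDiffAt (IQ.prod 𝓘(ℝ, AlgebroidModelFiber EG EQ)) 𝓘(ℝ, EQ × AlgebroidModelFiber EG EQ →L[ℝ] EG) ∞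
      (fun x : h.AlgebroidSpace => (h.frame p.1 x.1).inverse) p := by
    refine ContMDiffAt.comp (g := fun q => (h.frame p.1 q).inverse) (f := fun x : h.AlgebroidSpace => x.1) p ?_ hp
    refine (hm.2.contDiffAt_map_inverse (n := ∞)).contMDiffAt.comp p.1 ((h.contMDiffOn_frame p.1).contMDiffAt ((h.isOpen_coordSet p.1).mem_nhds hm.1))
  have h2 := h1.clm_apply ((contMDiffAt_const (c := (ContinuousLinearMap.inr ℝ EQ (AlgebroidModelFiber EG EQ)))).clm_apply hid.2)
  refine h2.congr_of_eventuallyEq ?_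
  have : (π (AlgebroidModelFiber EG EQ) (Algebroid h)) ⁻¹' (h.trivSet p.1) ∈ 𝓝 p :=
    hp.continuousAt.preimage_mem_nhds ((h.isOpen_trivSet p.1).mem_nhds hm)
  filter_upwards [this] with x hx
  have hx : x.1 ∈ h.trivSet p.1 := hx
  have e1 : (trivializationAt EG (TangentSpace IG) (D.unit p.1)).continuousLinearMapAt ℝ (D.unit x.1) = chartDeriv h p.1 x.1 :=
      TangentBundle.continuousLinearMapAt_trivializationAt hx.1.1
  have e2 := DFunLike.congr_fun e1 (Algebroid.toTangent h x.1 x.2)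
  have e3 : D.unit x.1 ∈ (trivializationAt EG (TangentSpace IG : G → Type _) (D.unit p.1)).baseSet := hx.1.1
  rw [Trivialization.continuousLinearMapAt_apply, Trivialization.coe_linearMapAt_of_mem _ e3] at e2
  refine e2.trans ?_
  have e4 := h.frame_chartDeriv hx _ (Algebroid.mfderiv_toTangent h x.1 x.2)
  have e5 := (hx.2.inverse_apply_self (chartDeriv h p.1 x.1 (Algebroid.toTangent h x.1 x.2))).symm
  rw [e4] at e5
  exact e5

/-- The vertical lift of `v ∈ A_q G` at the zero vector of `A_q G`: the velocity at `t = 0` of the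
curve `t ↦ t v`. -/
def verticalLift (q : Q) (v : Algebroid h q) :
    TangentSpace (IQ.prod 𝓘(ℝ, AlgebroidModelFiber EG EQ)) (⟨q, 0⟩ : h.AlgebroidSpace) :=
  mfderiv 𝓘(ℝ, ℝ) (IQ.prod 𝓘(ℝ, AlgebroidModelFiber EG EQ))
    (fun t : ℝ => (⟨q, t • v⟩ : h.AlgebroidSpace)) 0 (1 : ℝ)

/-- The derivative of `R : AG → G` at `0_q` along the vertical lift of `v ∈ A_q G`. As the vertical
lift is tangent to the fibre, this is `T_{0_q} (R|_{A_q G})` applied to the vertical lift. -/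
def verticalDeriv (R : h.AlgebroidSpace → G) (q : Q) (v : Algebroid h q) :
    TangentSpace IG (R ⟨q, 0⟩) :=
  mfderiv (IQ.prod 𝓘(ℝ, AlgebroidModelFiber EG EQ)) IG R ⟨q, 0⟩ (h.verticalLift q v)

/-- `R : AG → G` is a generalized discretization map on the Lie groupoid `G ⇉ Q`: it is smooth, it
sends `0_q` to `ε(q)`, and for all `v ∈ A_q G` with vertical lift `vᵛ` at `0_q` one has
`TR (vᵛ) = v + (T_q ε ∘ T_{ε(q)} α ∘ TR) (vᵛ)` in `T_{ε(q)} G`, the tangent space at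
`R 0_q = ε(q)`. -/
structure IsGeneralizedDiscretizationMap (R : h.AlgebroidSpace → G) : Prop where
  contMDiff : ContMDiff (IQ.prod 𝓘(ℝ, AlgebroidModelFiber EG EQ)) IG ∞ R
  map_zero : ∀ q : Q, R ⟨q, 0⟩ = D.unit q
  map_verticalLift : ∀ (q : Q) (v : Algebroid h q),
    (show TangentSpace IG (D.unit q) from h.verticalDeriv R q v) =
      Algebroid.toTangent h q v +
        mfderiv IQ IG D.unit q (mfderiv IG IQ D.source (D.unit q) (h.verticalDeriv R q v))

/-- Multiplication by `t` in the fibres of `AG`. -/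
def smulMap (t : ℝ) (p : h.AlgebroidSpace) : h.AlgebroidSpace := ⟨p.1, t • p.2⟩

/-- The total space of the Whitney sum `AG ⊕ AG → Q`. -/
abbrev AlgebroidSumSpace : Type _ :=
  TotalSpace (AlgebroidModelFiber EG EQ × AlgebroidModelFiber EG EQ)
    (Algebroid h ×ᵇ Algebroid h)

/-- The first projection `AG ⊕ AG → AG`. -/
def sumFst (p : h.AlgebroidSumSpace) : h.AlgebroidSpace := ⟨p.1, p.2.1⟩

/-- The second projection `AG ⊕ AG → AG`. -/
def sumSnd (p : h.AlgebroidSumSpace) : h.AlgebroidSpace := ⟨p.1, p.2.2⟩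

/-- Fibrewise addition `AG ⊕ AG → AG`. -/
def sumAdd (p : h.AlgebroidSumSpace) : h.AlgebroidSpace := ⟨p.1, p.2.1 + p.2.2⟩

end GroupoidData.IsLieGroupoid

/-- The canonical involution of the double tangent bundle `TTM`. The tangent space of a manifold at a
point is the model space, a vector being represented by its components in the preferred chart at
that point, and the preferred chart of `TM` at `(x, v)` is the one induced by the preferred chart of
`M` at `x`, in which the fibre component of `(x, v)` is `v`. So this is the usual
`(x, v; a, b) ↦ (x, a; v, b)` in induced coordinates. -/
def canonicalInvolution (I : ModelWithCorners ℝ EG HG) [IsManifold I 1 G]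
    (ξ : TangentBundle I.tangent (TangentBundle I G)) :
    TangentBundle I.tangent (TangentBundle I G) :=
  ⟨⟨ξ.1.1, (show EG × EG from ξ.2).1⟩,
    (show EG × EG from ((show EG from ξ.1.2), (show EG × EG from ξ.2).2))⟩

namespace GroupoidData.IsLieGroupoid

/-- `J` is the canonical isomorphism from `Tτ : T(AG) → TQ` to the Lie algebroid `A(TG) → TQ` of the
tangent groupoid. It is the restriction of the canonical involution of `TTG` to
`T(AG) ⊆ TTG`, it covers the identity of `TQ`, and it is linear in the fibres, where the addition and
the multiplication by scalars of the vector bundle `Tτ : T(AG) → TQ` are the tangent maps of the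
addition and the multiplication by scalars of `AG`. -/
structure IsCanonicalAlgebroidIso {D : GroupoidData G Q} (h : D.IsLieGroupoid IG IQ)
    (hT : (D.tangent IG IQ).IsLieGroupoid IG.tangent IQ.tangent)
    (J : TangentBundle (IQ.prod 𝓘(ℝ, AlgebroidModelFiber EG EQ)) h.AlgebroidSpace →
      hT.AlgebroidSpace) : Prop where
  inclusion_apply : ∀ ξ, hT.inclusion (J ξ) = canonicalInvolution IG
    (tangentMap (IQ.prod 𝓘(ℝ, AlgebroidModelFiber EG EQ)) IG.tangent h.inclusion ξ)
  proj_apply : ∀ ξ, (J ξ).1 = tangentMap (IQ.prod 𝓘(ℝ, AlgebroidModelFiber EG EQ)) IQ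
    (π (AlgebroidModelFiber EG EQ) (Algebroid h)) ξ
  map_add : ∀ Ξ : TangentBundle
      (IQ.prod 𝓘(ℝ, AlgebroidModelFiber EG EQ × AlgebroidModelFiber EG EQ)) h.AlgebroidSumSpace,
    ∃ (w : TangentBundle IQ Q) (u v : Algebroid hT w),
      J (tangentMap _ (IQ.prod 𝓘(ℝ, AlgebroidModelFiber EG EQ)) h.sumFst Ξ) = ⟨w, u⟩ ∧
      J (tangentMap _ (IQ.prod 𝓘(ℝ, AlgebroidModelFiber EG EQ)) h.sumSnd Ξ) = ⟨w, v⟩ ∧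
      J (tangentMap _ (IQ.prod 𝓘(ℝ, AlgebroidModelFiber EG EQ)) h.sumAdd Ξ) = ⟨w, u + v⟩
  map_smul : ∀ (t : ℝ) ξ,
    J (tangentMap (IQ.prod 𝓘(ℝ, AlgebroidModelFiber EG EQ))
      (IQ.prod 𝓘(ℝ, AlgebroidModelFiber EG EQ)) (h.smulMap t) ξ) = ⟨(J ξ).1, t • (J ξ).2⟩

end GroupoidData.IsLieGroupoid

end LieGroupoidDefs

/-! Everything is reduced to velocities of curves and of two-parameter maps. An identity of tangent
maps is proved by differentiating an identity of points along a curve, and a vector of a double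
tangent bundle is a mixed second derivative `∂ₜ∂ₛ f` of some map `f (t, s)`, on which the canonical
involution `κ` acts by exchanging the two parameters. That is the symmetry of second derivatives
(`HasVelocity.sweep_swap`).

Tangent groupoid: if `Tβ X = Tα Y` and `c` has velocity `X`, a curve through `Y` can be corrected by
a local section of the submersion `α` so that it becomes composable with `c` and keeps the velocity
`Y` (`exists_composable_curve`). The groupoid axioms for `TG` are the derivatives of those for `G`
along such curves. The same local section extends `m` from `G₂` to an open subset of `G × G`, which
gives the smoothness of `Tm`.

Algebroid: `AG ⊆ TG` is cut out by the conditions "the base point is `ε q`" and "`Tα` gives the zero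
vector over `q`". Their derivatives hold for `ζ` in `T(AG)` over `w` in `TQ`: `Tπ ζ = Tε w` and `TTα
ζ = T0 w`. Since `κ` is natural, exchanges `Tπ` with the projection of `TTG` to `TG`, and exchanges
`T0` with the zero section of `TTQ`, it turns these into the equations of `A(TG)`. Conversely, a
vector satisfying the differentiated equations at a point of `AG` is tangent to `AG`, because it is
fixed by the tangent map of a local retraction `TG → AG` (`tangentMap_inclusion_retraction`). The
retraction also gives the smoothness of `J⁻¹`, and linearity follows by differentiating fibrewise
sums and multiples along curves.

Discretization map: let `U = J ξ`, let `c` be a curve in `AG` with velocity `ξ`, and put `f (t, s) =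
R (t c(s))`. Linearity of `J` gives `∂ₛ f (t, 0) = (TR ∘ J⁻¹) (t U)`, so the derivative to be
computed is `ζ = ∂ₜ∂ₛ f (0, 0)`. The hypothesis on `R` says `∂ₜ f (0, s) = c(s) + Tε Tα ∂ₜ f (0, s)`
for each `s`. Its derivative in `s`, after applying `κ`, is the required identity for `ζ`, as `κ`
commutes with `TTε` and `TTα` and sends the inclusion of `ξ` to that of `U`. -/

/-! ### Velocities of curves -/

section Velocity

variable {E H M E' H' M' : Type*}
  [NormedAddCommGroup E] [NormedSpace ℝ E] [TopologicalSpace H] {I : ModelWithCorners ℝ E H}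
  [TopologicalSpace M] [ChartedSpace H M]
  [NormedAddCommGroup E'] [NormedSpace ℝ E'] [TopologicalSpace H'] {I' : ModelWithCorners ℝ E' H'}
  [TopologicalSpace M'] [ChartedSpace H' M']

/-- The curve `c` is differentiable at `0` and its velocity there is the tangent vector `X`. -/
def HasVelocity (I : ModelWithCorners ℝ E H) (c : ℝ → M) (X : TangentBundle I M) : Prop :=
  MDifferentiableAt 𝓘(ℝ, ℝ) I c 0 ∧ tangentMap 𝓘(ℝ, ℝ) I c ⟨0, (1 : ℝ)⟩ = X

theorem HasVelocity.apply_zero {c : ℝ → M} {X : TangentBundle I M} (h : HasVelocity I c X) :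
    c 0 = X.1 := by
  rw [← h.2]; rfl

theorem HasVelocity.continuousAt {c : ℝ → M} {X : TangentBundle I M} (h : HasVelocity I c X) :
    ContinuousAt c 0 := h.1.continuousAt

theorem HasVelocity.unique {c : ℝ → M} {X Y : TangentBundle I M} (h : HasVelocity I c X)
    (h' : HasVelocity I c Y) : X = Y := h.2.symm.trans h'.2

theorem MDifferentiableAt.hasVelocity {c : ℝ → M} (h : MDifferentiableAt 𝓘(ℝ, ℝ) I c 0) :
    HasVelocity I c ⟨c 0, mfderiv 𝓘(ℝ, ℝ) I c 0 (1 : ℝ)⟩ := ⟨h, rfl⟩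

theorem HasMFDerivAt.hasVelocity {c : ℝ → M} {f' : ℝ →L[ℝ] TangentSpace I (c 0)}
    (h : HasMFDerivAt 𝓘(ℝ, ℝ) I c 0 f') :
    HasVelocity I c ⟨c 0, f' (1 : ℝ)⟩ := by
  refine ⟨h.mdifferentiableAt, ?_⟩
  rw [tangentMap, h.mfderiv]
  rfl

theorem HasVelocity.congr {c c' : ℝ → M} {X : TangentBundle I M} (h : HasVelocity I c X)
    (hc : c' =ᶠ[𝓝 0] c) : HasVelocity I c' X := by
  have h1 := (h.1.hasMFDerivAt.congr_of_eventuallyEq hc).hasVelocity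
  convert h1 using 1
  rw [← h.2]
  have := hc.eq_of_nhds
  simp only [tangentMap]
  rw [this]
  rfl

theorem HasVelocity.comp {c : ℝ → M} {X : TangentBundle I M} {f : M → M'}
    (hf : MDifferentiableAt I I' f X.1) (h : HasVelocity I c X) :
    HasVelocity I' (f ∘ c) (tangentMap I I' f X) := by
  obtain ⟨h1, rfl⟩ := h
  exact (HasMFDerivAt.comp (0 : ℝ) hf.hasMFDerivAt h1.hasMFDerivAt).hasVelocity

/-- The preimage of `s` under the curve is a neighbourhood of `0`, so the derivative there is
unrestricted. Unique differentiability of `s` is not needed, which is what allows `s` to be the set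
of composable pairs. -/
theorem HasVelocity.comp_within {c : ℝ → M} {X : TangentBundle I M} {f : M → M'} {s : Set M}
    (hf : MDifferentiableWithinAt I I' f s X.1) (h : HasVelocity I c X) (hs : ∀ᶠ t in 𝓝 0, c t ∈ s) :
    HasVelocity I' (f ∘ c) (tangentMapWithin I I' f s X) := by
  obtain ⟨h1, rfl⟩ := h
  have h2 := HasMFDerivWithinAt.comp (s := c ⁻¹' s) (0 : ℝ) hf.hasMFDerivWithinAt
    (h1.hasMFDerivAt.hasMFDerivWithinAt) subset_rfl
  exact (h2.hasMFDerivAt hs).hasVelocity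

theorem HasVelocity.prodMk {c : ℝ → M} {c' : ℝ → M'} {X : TangentBundle I M}
    {Y : TangentBundle I' M'} (h : HasVelocity I c X) (h' : HasVelocity I' c' Y) :
    HasVelocity (I.prod I') (fun t => (c t, c' t)) ((equivTangentBundleProd I M I' M').symm (X, Y)) := by
  obtain ⟨h1, rfl⟩ := h
  obtain ⟨h2, rfl⟩ := h'
  exact (h1.hasMFDerivAt.prodMk h2.hasMFDerivAt).hasVelocity

theorem hasVelocity_of_hasDerivAt {c : ℝ → E} {v : E} (h : HasDerivAt c v 0) :
    HasVelocity 𝓘(ℝ, E) c ⟨c 0, v⟩ := by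
  have := h.hasFDerivAt.hasMFDerivAt.hasVelocity
  rwa [show (⟨c 0, v⟩ : TangentBundle 𝓘(ℝ, E) E) = ⟨c 0, ContinuousLinearMap.toSpanSingleton ℝ v 1⟩
    from congrArg _ (one_smul ℝ v).symm]

theorem HasVelocity.hasDerivAt {c : ℝ → E} {X : TangentBundle 𝓘(ℝ, E) E}
    (h : HasVelocity 𝓘(ℝ, E) c X) : HasDerivAt c X.2 0 := by
  obtain ⟨h1, rfl⟩ := h
  have := h1.differentiableAt.hasDerivAt
  convert this using 1
  simp only [tangentMap, mfderiv_eq_fderiv]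
  rfl

variable [IsManifold I 1 M]

theorem HasVelocity.hasDerivAt_extChartAt {c : ℝ → M} {X : TangentBundle I M}
    (h : HasVelocity I c X) {p : M} (hp : X.1 ∈ (chartAt H p).source) :
    HasDerivAt (extChartAt I p ∘ c) (mfderiv I 𝓘(ℝ, E) (extChartAt I p) X.1 X.2) 0 :=
  (h.comp (mdifferentiableAt_extChartAt hp)).hasDerivAt

/-- Continuity is a separate hypothesis: outside its source the chart takes junk values, so
differentiability of the composite alone says nothing about where `c` goes. -/
theorem hasVelocity_of_hasDerivAt_extChartAt [I.Boundaryless] {c : ℝ → M} {X : TangentBundle I M}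
    (hc : ContinuousAt c 0) (h0 : c 0 = X.1) (hd : HasDerivAt (extChartAt I X.1 ∘ c) X.2 0) :
    HasVelocity I c X := by
  obtain ⟨x, v⟩ := X
  dsimp only at h0 hd
  subst h0
  have h1 : MDifferentiableAt 𝓘(ℝ, ℝ) I c 0 := by
    rw [mdifferentiableAt_iff_target]
    exact ⟨hc, hd.differentiableAt.mdifferentiableAt⟩
  have h2 := (h1.hasVelocity.hasDerivAt_extChartAt (mem_chart_source H (c 0))).unique hd
  rw [mfderiv_extChartAt_self] at h2
  refine ⟨h1, ?_⟩
  rw [← h2]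
  rfl

/-- The curve is a straight line in the preferred chart. The line may leave the chart, hence
regularity only at `0`. -/
theorem exists_hasVelocity [I.Boundaryless] {n : WithTop ℕ∞} [IsManifold I n M] (X : TangentBundle I M) :
    ∃ c : ℝ → M, ContMDiffAt 𝓘(ℝ, ℝ) I n c 0 ∧ HasVelocity I c X := by
  let φ := extChartAt I X.1
  let v : E := X.2
  let l : ℝ → E := fun t => φ X.1 + t • v
  have hl : ContDiff ℝ n l := by fun_prop
  have hl0 : l 0 = φ X.1 := by simp [l]
  have hs : ContMDiffAt 𝓘(ℝ, E) I n φ.symm (l 0) := by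
    have := contMDiffWithinAt_extChartAt_symm_range (I := I) (n := n) X.1
      (mem_extChartAt_target (I := I) X.1)
    rw [I.range_eq_univ, contMDiffWithinAt_univ] at this
    rwa [hl0]
  have hc : ContMDiffAt 𝓘(ℝ, ℝ) I n (φ.symm ∘ l) 0 := hs.comp 0 hl.contMDiff.contMDiffAt
  refine ⟨φ.symm ∘ l, hc, hasVelocity_of_hasDerivAt_extChartAt hc.continuousAt ?_ ?_⟩
  · simp only [Function.comp_apply, hl0]
    exact extChartAt_to_inv X.1
  · have h1 : HasDerivAt l v 0 := by
      simpa [l] using ((hasDerivAt_id (0 : ℝ)).smul_const v).const_add (φ X.1)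
    refine h1.congr_of_eventuallyEq ?_
    have h2 : l ⁻¹' φ.target ∈ 𝓝 0 :=
      hl.continuous.continuousAt.preimage_mem_nhds (by rw [hl0]; exact extChartAt_target_mem_nhds X.1)
    filter_upwards [h2] with t ht
    exact φ.right_inv ht

end Velocity

/-! ### Submersions and their tangent maps -/

section Submersion

variable {E H M E' H' M' : Type*}
  [NormedAddCommGroup E] [NormedSpace ℝ E] [TopologicalSpace H] {I : ModelWithCorners ℝ E H}
  [TopologicalSpace M] [ChartedSpace H M]
  [NormedAddCommGroup E'] [NormedSpace ℝ E'] [TopologicalSpace H'] {I' : ModelWithCorners ℝ E' H'}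
  [TopologicalSpace M'] [ChartedSpace H' M']

/-- A submersion `f` has, near a given point, smooth local sections through all points: there is
`σ (q, y)` with `f (σ (q, y)) = q` and `σ (f y, y) = y`. -/
theorem Manifold.IsSubmersionAt.exists_section [I.Boundaryless] {n : WithTop ℕ∞} {f : M → M'}
    {x : M} (h : Manifold.IsSubmersionAt I I' n f x) :
    ∃ (U : Set (M' × M)) (σ : M' × M → M), IsOpen U ∧ (f x, x) ∈ U ∧
      ContMDiffOn (I'.prod I) I n σ U ∧ (∀ p ∈ U, f (σ p) = p.1) ∧
      ∀ y, (f y, y) ∈ U → σ (f y, y) = y := by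
  let φ := h.domChart.extend I
  let ψ := h.codChart.extend I'
  let e := h.equiv
  -- In these charts `f` is the first projection of `E' × complement`. The section keeps the
  -- complement coordinate of `y` and replaces the first coordinate by that of `q`.
  let z : M' × M → E := fun p => e.symm (ψ p.1, (e (φ p.2)).2)
  let V : Set (M' × M) := h.codChart.source ×ˢ h.domChart.source
  have hV : IsOpen V := h.codChart.open_source.prod h.domChart.open_source
  have hz : ContMDiffOn (I'.prod I) 𝓘(ℝ, E) n z V := by
    have h1 : ContMDiffOn (I'.prod I) 𝓘(ℝ, E') n (fun p : M' × M => ψ p.1) V :=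
      (OpenPartialHomeomorph.contMDiffOn_extend h.codChart_mem_maximalAtlas).comp contMDiffOn_fst
        fun p hp => hp.1
    have h2 : ContMDiffOn (I'.prod I) 𝓘(ℝ, E) n (fun p : M' × M => φ p.2) V :=
      (OpenPartialHomeomorph.contMDiffOn_extend h.domChart_mem_maximalAtlas).comp contMDiffOn_snd
        fun p hp => hp.2
    have h3 : ContMDiffOn (I'.prod I) 𝓘(ℝ, h.complement) n (fun p : M' × M => (e (φ p.2)).2) V :=
      ((ContinuousLinearMap.snd ℝ E' h.complement).comp
        (e : E →L[ℝ] E' × h.complement)).contMDiff.comp_contMDiffOn h2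
    exact (e.symm : E' × h.complement →L[ℝ] E).contMDiff.comp_contMDiffOn (h1.prodMk_space h3)
  have hval : ∀ y ∈ h.domChart.source, z (f y, y) = φ y := by
    intro y hy
    have hy' : y ∈ φ.source := by rwa [OpenPartialHomeomorph.extend_source]
    have h1 := h.writtenInCharts (φ.map_source hy')
    simp only [Function.comp_apply] at h1
    have h2 : φ.symm (φ y) = y := φ.left_inv hy'
    change ψ (f (φ.symm (φ y))) = (e (φ y)).1 at h1
    rw [h2] at h1
    simp only [z, h1, Prod.mk.eta, ContinuousLinearEquiv.symm_apply_apply]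
  have ht : IsOpen φ.target := h.domChart.isOpen_extend_target
  refine ⟨V ∩ z ⁻¹' φ.target, fun p => φ.symm (z p), hz.continuousOn.isOpen_inter_preimage hV ht,
    ⟨⟨h.mem_codChart_source, h.mem_domChart_source⟩, ?_⟩, ?_, ?_, ?_⟩
  · have hx : x ∈ φ.source := by
      rw [OpenPartialHomeomorph.extend_source]; exact h.mem_domChart_source
    rw [mem_preimage, hval x h.mem_domChart_source]
    exact φ.map_source hx
  · refine (contMDiffOn_extend_symm h.domChart_mem_maximalAtlas).comp (hz.mono inter_subset_left) ?_
    intro p hp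
    have := hp.2
    rwa [mem_preimage, OpenPartialHomeomorph.extend_target'] at this
  · rintro ⟨q, y⟩ ⟨⟨hq, hy⟩, hp⟩
    have h1 := h.writtenInCharts hp
    change ψ (f (φ.symm (z (q, y)))) = (e (z (q, y))).1 at h1
    simp only [z, ContinuousLinearEquiv.apply_symm_apply] at h1
    have h2 : φ.symm (z (q, y)) ∈ h.domChart.source := by
      have := φ.map_target hp
      rwa [OpenPartialHomeomorph.extend_source] at this
    change f (φ.symm (z (q, y))) = q
    refine ψ.injOn ?_ ?_ h1
    · rw [OpenPartialHomeomorph.extend_source]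
      exact h.source_subset_preimage_source h2
    · rw [OpenPartialHomeomorph.extend_source]
      exact hq
  · rintro y ⟨⟨-, hy⟩, -⟩
    simp only [hval y hy]
    exact φ.left_inv (by rwa [OpenPartialHomeomorph.extend_source])

theorem Filter.EventuallyEq.tangentMap_eq {f g : M → M'} {X : TangentBundle I M}
    (h : f =ᶠ[𝓝 X.1] g) : tangentMap I I' f X = tangentMap I I' g X := by
  have h1 : ∀ {y y' : M'} (w : E'), y = y' → (⟨y, w⟩ : TangentBundle I' M') = ⟨y', w⟩ := by
    rintro y _ w rfl
    rfl
  simp only [tangentMap, h.mfderiv_eq]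
  exact h1 _ h.eq_of_nhds

theorem ContMDiffAt.eventually_mdifferentiableAt [IsManifold I 1 M] [IsManifold I' 1 M']
    {f : M → M'} {x : M}
    (hf : ContMDiffAt I I' 1 f x) : ∀ᶠ y in 𝓝 x, MDifferentiableAt I I' f y := by
  filter_upwards [(contMDiffAt_iff_contMDiffAt_nhds (by simp)).1 hf] with y hy
  exact hy.mdifferentiableAt (by simp)

theorem tangentMap_eq_self_of_leftInv {f : M → M'} {g : M' → M} {X : TangentBundle I M}
    (hg : MDifferentiableAt I' I g (f X.1)) (hf : MDifferentiableAt I I' f X.1)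
    (h : ∀ᶠ y in 𝓝 X.1, g (f y) = y) : tangentMap I' I g (tangentMap I I' f X) = X := by
  rw [← tangentMap_comp_at X hg hf]
  refine (Filter.EventuallyEq.tangentMap_eq (g := id) h).trans ?_
  rw [tangentMap_id]
  rfl

variable [IsManifold I ∞ M] [IsManifold I' ∞ M']

theorem ContMDiffOn.tangentMap_of_isOpen {f : M → M'} {s : Set M} (hf : ContMDiffOn I I' ∞ f s)
    (hs : IsOpen s) :
    ContMDiffOn I.tangent I'.tangent ∞ (tangentMap I I' f) (π E (TangentSpace I) ⁻¹' s) := by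
  refine (hf.contMDiffOn_tangentMapWithin (m := ∞) (by simp) hs.uniqueMDiffOn).congr ?_
  intro X hX
  simp only [tangentMap, tangentMapWithin, mfderivWithin_of_isOpen hs hX]

/-- The chart of `TM` induced by a chart of `M`. -/
noncomputable def tangentChart (e : OpenPartialHomeomorph M H) (he : e ∈ IsManifold.maximalAtlas I ∞ M) :
    OpenPartialHomeomorph (TangentBundle I M) (ModelProd H E) where
  toFun X := tangentBundleModelSpaceHomeomorph I (tangentMap I I e X)
  invFun p := tangentMap I I e.symm ((tangentBundleModelSpaceHomeomorph I).symm p)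
  source := π E (TangentSpace I) ⁻¹' e.source
  target := e.target ×ˢ univ
  map_source' X hX := ⟨e.map_source hX, mem_univ _⟩
  map_target' p hp := e.map_target hp.1
  left_inv' := by
    intro X hX
    rw [Homeomorph.symm_apply_apply]
    refine tangentMap_eq_self_of_leftInv ?_ ?_ (e.eventually_left_inverse hX)
    · exact (contMDiffAt_symm_of_mem_maximalAtlas he (e.map_source hX)).mdifferentiableAt (by simp)
    · exact (contMDiffAt_of_mem_maximalAtlas he hX).mdifferentiableAt (by simp)
  right_inv' := by
    intro p hp
    rw [tangentMap_eq_self_of_leftInv (X := (tangentBundleModelSpaceHomeomorph I).symm p) (I := I) (I' := I) ?_ ?_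
      (e.eventually_right_inverse hp.1), Homeomorph.apply_symm_apply]
    · exact (contMDiffAt_of_mem_maximalAtlas he (e.map_target hp.1)).mdifferentiableAt (by simp)
    · exact (contMDiffAt_symm_of_mem_maximalAtlas he hp.1).mdifferentiableAt (by simp)
  open_source := e.open_source.preimage (FiberBundle.continuous_proj _ _)
  open_target := e.open_target.prod isOpen_univ
  continuousOn_toFun :=
    (tangentBundleModelSpaceHomeomorph I).continuous.comp_continuousOn
      ((contMDiffOn_of_mem_maximalAtlas he).tangentMap_of_isOpen e.open_source).continuousOn
  continuousOn_invFun :=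
    ((contMDiffOn_symm_of_mem_maximalAtlas he).tangentMap_of_isOpen e.open_target).continuousOn.comp
      (tangentBundleModelSpaceHomeomorph I).symm.continuous.continuousOn fun _ hp => hp.1

theorem tangentChart_mem_maximalAtlas (e : OpenPartialHomeomorph M H)
    (he : e ∈ IsManifold.maximalAtlas I ∞ M) :
    tangentChart e he ∈ IsManifold.maximalAtlas I.tangent ∞ (TangentBundle I M) := by
  apply OpenPartialHomeomorph.mem_maximalAtlas_of_contMDiffOn
  · have h1 := contMDiff_tangentBundleModelSpaceHomeomorph (I := I) (n := ∞)
    have h2 := h1.comp_contMDiffOn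
      ((contMDiffOn_of_mem_maximalAtlas he).tangentMap_of_isOpen e.open_source)
    convert h2 using 1
    all_goals rfl
  · have h1 := contMDiff_tangentBundleModelSpaceHomeomorph_symm (I := I) (n := ∞)
    exact ((contMDiffOn_symm_of_mem_maximalAtlas he).tangentMap_of_isOpen e.open_target).comp
      h1.contMDiffOn fun _ hp => hp.1

theorem HasVelocity.hasDerivAt_model {c : ℝ → H} {X : TangentBundle I H} (h : HasVelocity I c X) :
    HasDerivAt (I ∘ c) X.2 0 := by
  have h1 := (h.comp I.mdifferentiableAt).hasDerivAt
  rwa [tangentMap_snd, I.hasMFDerivAt.mfderiv] at h1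

/-- Without boundary `I` is onto, so straight lines in `E` are curves in `H`. They serve as test
curves for a tangent map read in the charts `tangentChart`. -/
theorem hasVelocity_modelWithCorners_symm [I.Boundaryless] (y v : E) :
    HasVelocity I (fun t : ℝ => I.symm (y + t • v)) ⟨I.symm y, v⟩ := by
  have h1 : HasMFDerivAt 𝓘(ℝ, E) I I.symm y (ContinuousLinearMap.id ℝ E) := by
    have := I.hasMFDerivWithinAt_symm (x := y) (by rw [I.range_eq_univ]; trivial)
    rw [I.range_eq_univ] at this
    exact hasMFDerivWithinAt_univ.1 this
  have h2 : HasDerivAt (fun t : ℝ => y + t • v) v 0 := by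
    simpa using ((hasDerivAt_id (0 : ℝ)).smul_const v).const_add y
  have h3 := hasVelocity_of_hasDerivAt h2
  have h0 : y + (0 : ℝ) • v = y := by simp
  rw [h0] at h3
  have h4 := h3.comp (f := I.symm) h1.mdifferentiableAt
  rw [tangentMap, h1.mfderiv] at h4
  exact h4

/-- The tangent map of a submersion is a submersion. -/
theorem Manifold.IsSubmersion.isSubmersion_tangentMap [I.Boundaryless] {f : M → M'}
    (h : Manifold.IsSubmersion I I' ∞ f) :
    Manifold.IsSubmersion I.tangent I'.tangent ∞ (tangentMap I I' f) := by
  refine Manifold.IsSubmersionOfComplement.isSubmersion (F := h.complement × h.complement) fun X => ?_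
  have hX := h.isSubmersionOfComplement_complement X.1
  -- The tangent map of a linear projection is that projection on points and again on velocities, so
  -- two copies of the normal form of `f` are used, regrouped with the two complements together.
  refine Manifold.IsSubmersionAtOfComplement.mk_of_charts
    ((hX.equiv.prodCongr hX.equiv).trans
      (ContinuousLinearEquiv.prodProdProdComm ℝ E' h.complement E' h.complement))
    (tangentChart hX.domChart hX.domChart_mem_maximalAtlas)
    (tangentChart hX.codChart hX.codChart_mem_maximalAtlas) hX.mem_domChart_source
    hX.mem_codChart_source (tangentChart_mem_maximalAtlas _ _) (tangentChart_mem_maximalAtlas _ _)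
    (fun Y hY => hX.source_subset_preimage_source hY) ?_
  rintro ⟨y, v⟩ hp
  have hy : I.symm y ∈ hX.domChart.target := by
    rw [OpenPartialHomeomorph.extend_target'] at hp
    obtain ⟨⟨z, w⟩, hz, hzw⟩ := hp
    have h1 : I z = y := congrArg Prod.fst hzw
    rw [← h1, I.left_inv]
    exact hz.1
  have hy' : y ∈ (hX.domChart.extend I).target := by
    rw [OpenPartialHomeomorph.extend_target']
    exact ⟨_, hy, I.right_inv (by rw [I.range_eq_univ]; trivial)⟩
  have hx : hX.domChart.symm (I.symm y) ∈ hX.domChart.source := hX.domChart.map_target hy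
  -- The velocity component is found by differentiating the normal form of `f` along the line `y + t
  -- v`.
  have h1 := (hasVelocity_modelWithCorners_symm (I := I) y v).comp (f := hX.domChart.symm)
    ((contMDiffAt_symm_of_mem_maximalAtlas hX.domChart_mem_maximalAtlas hy).mdifferentiableAt (by simp))
  have h2 := h1.comp (f := f) ((h.contMDiff _).mdifferentiableAt (by simp))
  have h3 := (h2.comp (f := hX.codChart) ((contMDiffAt_of_mem_maximalAtlas hX.codChart_mem_maximalAtlas
    (hX.source_subset_preimage_source hx)).mdifferentiableAt (by simp))).hasDerivAt_model
  have h4 : HasDerivAt (fun t : ℝ => (hX.equiv (y + t • v)).1) (hX.equiv v).1 0 := by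
    have h5 : HasDerivAt (fun t : ℝ => y + t • v) v 0 := by
      simpa using ((hasDerivAt_id (0 : ℝ)).smul_const v).const_add y
    exact (((ContinuousLinearMap.fst ℝ E' h.complement).comp
      (hX.equiv : E →L[ℝ] E' × h.complement)).hasFDerivAt).comp_hasDerivAt (0 : ℝ) h5
  refine Prod.ext (hX.writtenInCharts hy') (h3.unique (h4.congr_of_eventuallyEq ?_))
  have h6 : (fun t : ℝ => y + t • v) ⁻¹' (hX.domChart.extend I).target ∈ 𝓝 0 := by
    refine ContinuousAt.preimage_mem_nhds (by fun_prop) ?_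
    simp only [zero_smul, add_zero]
    exact hX.domChart.isOpen_extend_target.mem_nhds hy'
  filter_upwards [h6] with t ht
  exact hX.writtenInCharts ht

end Submersion

/-! ### The tangent groupoid -/

namespace GroupoidData.IsLieGroupoid

variable {EG HG G EQ HQ Q : Type*}
  [NormedAddCommGroup EG] [NormedSpace ℝ EG] [TopologicalSpace HG]
  [NormedAddCommGroup EQ] [NormedSpace ℝ EQ] [TopologicalSpace HQ]
  [TopologicalSpace G] [ChartedSpace HG G] [TopologicalSpace Q] [ChartedSpace HQ Q]
  {IG : ModelWithCorners ℝ EG HG} {IQ : ModelWithCorners ℝ EQ HQ}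
  [IG.Boundaryless] [IQ.Boundaryless] [IsManifold IG ∞ G] [IsManifold IQ ∞ Q]
  {D : GroupoidData G Q} (h : D.IsLieGroupoid IG IQ)

include h

omit [IG.Boundaryless] [IQ.Boundaryless] [IsManifold IG ∞ G] [IsManifold IQ ∞ Q] in
theorem mdifferentiableAt_source (g : G) : MDifferentiableAt IG IQ D.source g :=
  (h.contMDiff_source g).mdifferentiableAt (by simp)

omit [IG.Boundaryless] [IQ.Boundaryless] [IsManifold IG ∞ G] [IsManifold IQ ∞ Q] in
theorem mdifferentiableAt_target (g : G) : MDifferentiableAt IG IQ D.target g :=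
  (h.contMDiff_target g).mdifferentiableAt (by simp)

omit [IG.Boundaryless] [IQ.Boundaryless] [IsManifold IG ∞ G] [IsManifold IQ ∞ Q] in
theorem mdifferentiableAt_unit (q : Q) : MDifferentiableAt IQ IG D.unit q :=
  (h.contMDiff_unit q).mdifferentiableAt (by simp)

omit [IG.Boundaryless] [IQ.Boundaryless] [IsManifold IG ∞ G] [IsManifold IQ ∞ Q] in
theorem mdifferentiableAt_inv (g : G) : MDifferentiableAt IG IG D.inv g :=
  (h.contMDiff_inv g).mdifferentiableAt (by simp)

omit [IG.Boundaryless] [IQ.Boundaryless] [IsManifold IG ∞ G] [IsManifold IQ ∞ Q] in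
/-- The product of composable curves has the product of the velocities in the tangent groupoid as
velocity. -/
theorem hasVelocity_mul {c c' : ℝ → G} {X Y : TangentBundle IG G} (hc : HasVelocity IG c X)
    (hc' : HasVelocity IG c' Y) (hcc' : ∀ᶠ t in 𝓝 0, D.target (c t) = D.source (c' t)) :
    HasVelocity IG (fun t => D.mul (c t) (c' t)) ((D.tangent IG IQ).mul X Y) := by
  have h0 : (X.1, Y.1) ∈ D.composable := by
    have := hcc'.self_of_nhds
    rwa [hc.apply_zero, hc'.apply_zero] at this
  exact (hc.prodMk hc').comp_within (s := D.composable) (f := fun p : G × G => D.mul p.1 p.2)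
    ((h.contMDiffOn_mul _ h0).mdifferentiableWithinAt (by simp)) hcc'

omit [IQ.Boundaryless] [IsManifold IQ ∞ Q] in
-- Take any curve `c₁` through `Y` and a local section `σ` of `α`; the curve `σ (β (c t), c₁ t)` has
-- source `β (c t)`. Its velocity is `Tσ (Tβ X, Y) = Tσ (Tα Y, Y)`, which is also the velocity of `σ
-- (α (c₁ t), c₁ t) = c₁ t`, that is, `Y`.
theorem exists_composable_curve {c : ℝ → G} {X Y : TangentBundle IG G} (hc : HasVelocity IG c X)
    (hXY : (D.tangent IG IQ).target X = (D.tangent IG IQ).source Y) :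
    ∃ c' : ℝ → G, HasVelocity IG c' Y ∧ ∀ᶠ t in 𝓝 0, D.target (c t) = D.source (c' t) := by
  obtain ⟨U, σ, hU, hYU, hσ, hσ1, hσ2⟩ := (h.isSubmersion_source.isSubmersionAt Y.1).exists_section
  obtain ⟨c₁, -, hc₁⟩ := exists_hasVelocity (n := ∞) Y
  have hd : MDifferentiableAt (IQ.prod IG) IG σ (D.source Y.1, Y.1) :=
    (hσ.contMDiffAt (hU.mem_nhds hYU)).mdifferentiableAt (by simp)
  have h1 := hc₁.comp (h.mdifferentiableAt_source _)
  have h2 := hc.comp (h.mdifferentiableAt_target _)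
  change tangentMap IG IQ D.target X = tangentMap IG IQ D.source Y at hXY
  rw [hXY] at h2
  have h3 := (h1.prodMk hc₁).comp (f := σ) hd
  have h4 := (h2.prodMk hc₁).comp (f := σ) hd
  have h5 : ∀ {d : ℝ → Q × G}, ContinuousAt d 0 → d 0 = (D.source Y.1, Y.1) →
      ∀ᶠ t in 𝓝 0, d t ∈ U := fun {d} hd h0 =>
    hd.preimage_mem_nhds (hU.mem_nhds (by rwa [h0]))
  have h6 := h5 (h1.prodMk hc₁).continuousAt (h1.prodMk hc₁).apply_zero
  have h7 := h5 (h2.prodMk hc₁).continuousAt (h2.prodMk hc₁).apply_zero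
  have h8 := h3.unique (hc₁.congr (by filter_upwards [h6] with t ht using hσ2 _ ht))
  rw [h8] at h4
  refine ⟨_, h4, ?_⟩
  filter_upwards [h7] with t ht
  exact (hσ1 _ ht).symm

/-- With a local section `σ` of `α`, the map `m' (g, k) = g · σ (β g, k)` is smooth on an open
subset of `G × G` and agrees with `m` on composable pairs. Testing on composable curves shows that
`Tm'` restricts to the tangent multiplication. -/
theorem contMDiffOn_tangent_mul :
    ContMDiffOn (IG.tangent.prod IG.tangent) IG.tangent ∞
      (fun p : TangentBundle IG G × TangentBundle IG G => (D.tangent IG IQ).mul p.1 p.2)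
      (D.tangent IG IQ).composable := by
  rintro ⟨X₀, Y₀⟩ hXY₀
  obtain ⟨U, σ, hU, hYU, hσ, hσ1, hσ2⟩ := (h.isSubmersion_source.isSubmersionAt Y₀.1).exists_section
  let U' : Set (G × G) := {p | (D.target p.1, p.2) ∈ U}
  have hf : ContMDiff (IG.prod IG) (IQ.prod IG) ∞ fun p : G × G => (D.target p.1, p.2) :=
    (h.contMDiff_target.comp contMDiff_fst).prodMk contMDiff_snd
  have hU' : IsOpen U' := hU.preimage hf.continuous
  let m' : G × G → G := fun p => D.mul p.1 (σ (D.target p.1, p.2))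
  have hm' : ContMDiffOn (IG.prod IG) IG ∞ m' U' := by
    have h1 : ContMDiffOn (IG.prod IG) (IG.prod IG) ∞
        (fun p : G × G => (p.1, σ (D.target p.1, p.2))) U' :=
      contMDiffOn_fst.prodMk (hσ.comp hf.contMDiffOn fun _ hp => hp)
    exact h.contMDiffOn_mul.comp h1 fun p hp => (hσ1 _ hp).symm
  have h0 : (X₀.1, Y₀.1) ∈ U' := by
    have : D.target X₀.1 = D.source Y₀.1 := congrArg TotalSpace.proj hXY₀
    change (D.target X₀.1, Y₀.1) ∈ U
    rwa [this]
  have h2 : ContMDiffAt (IG.prod IG).tangent IG.tangent ∞ (tangentMap (IG.prod IG) IG m')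
      ((equivTangentBundleProd IG G IG G).symm (X₀, Y₀)) :=
    (hm'.tangentMap_of_isOpen hU').contMDiffAt
      ((hU'.preimage (FiberBundle.continuous_proj _ _)).mem_nhds h0)
  have h3 : ContMDiffAt (IG.tangent.prod IG.tangent) (IG.prod IG).tangent ∞
      (equivTangentBundleProd IG G IG G).symm (X₀, Y₀) :=
    contMDiff_equivTangentBundleProd_symm (n := ∞) _
  have hev : ∀ᶠ p : TangentBundle IG G × TangentBundle IG G in 𝓝 (X₀, Y₀), (p.1.1, p.2.1) ∈ U' := by
    refine ContinuousAt.preimage_mem_nhds (f := fun p : TangentBundle IG G × TangentBundle IG G =>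
      (p.1.1, p.2.1)) ?_ (hU'.mem_nhds h0)
    exact (((FiberBundle.continuous_proj EG (TangentSpace IG : G → Type _)).comp continuous_fst).prodMk
      ((FiberBundle.continuous_proj EG (TangentSpace IG : G → Type _)).comp continuous_snd)).continuousAt
  have key : ∀ p ∈ (D.tangent IG IQ).composable, (p.1.1, p.2.1) ∈ U' →
      (D.tangent IG IQ).mul p.1 p.2 =
        tangentMap (IG.prod IG) IG m' ((equivTangentBundleProd IG G IG G).symm p) := by
    rintro ⟨X, Y⟩ hXY hU''
    obtain ⟨c, -, hc⟩ := exists_hasVelocity (n := ∞) X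
    obtain ⟨c', hc', hcc'⟩ := h.exists_composable_curve hc hXY
    have h5 := (hc.prodMk hc').comp (f := m')
      ((hm'.contMDiffAt (hU'.mem_nhds hU'')).mdifferentiableAt (by simp))
    refine (h.hasVelocity_mul hc hc' hcc').unique (h5.congr ?_)
    have h6 : ∀ᶠ t in 𝓝 0, (c t, c' t) ∈ U' :=
      (hc.prodMk hc').continuousAt.preimage_mem_nhds
        (hU'.mem_nhds (by rw [(hc.prodMk hc').apply_zero]; exact hU''))
    filter_upwards [h6, hcc'] with t ht ht'
    change (D.target (c t), c' t) ∈ U at ht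
    simp only [Function.comp_apply, m', ht'] at ht ⊢
    rw [hσ2 _ ht]
  refine (h2.comp (X₀, Y₀) h3).contMDiffWithinAt.congr_of_eventuallyEq ?_ (key _ hXY₀ h0)
  filter_upwards [self_mem_nhdsWithin, mem_nhdsWithin_of_mem_nhds hev] with p hp hp'
  exact key p hp hp'

/-- The tangent groupoid of a Lie groupoid is a Lie groupoid. -/
theorem tangent : (D.tangent IG IQ).IsLieGroupoid IG.tangent IQ.tangent where
  source_unit w := tangentMap_eq_self_of_leftInv (h.mdifferentiableAt_source _)
    (h.mdifferentiableAt_unit _) (.of_forall h.source_unit)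
  target_unit w := tangentMap_eq_self_of_leftInv (h.mdifferentiableAt_target _)
    (h.mdifferentiableAt_unit _) (.of_forall h.target_unit)
  -- From here to `mul_inv`, each axiom is the corresponding axiom of `G` along curves with the
  -- given velocities, followed by uniqueness of the velocity.
  source_mul X Y hXY := by
    obtain ⟨c, -, hc⟩ := exists_hasVelocity (n := ∞) X
    obtain ⟨c', hc', hcc'⟩ := h.exists_composable_curve hc hXY
    refine ((h.hasVelocity_mul hc hc' hcc').comp (h.mdifferentiableAt_source _)).unique
      ((hc.comp (h.mdifferentiableAt_source _)).congr ?_)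
    filter_upwards [hcc'] with t ht using h.source_mul _ _ ht
  target_mul X Y hXY := by
    obtain ⟨c, -, hc⟩ := exists_hasVelocity (n := ∞) X
    obtain ⟨c', hc', hcc'⟩ := h.exists_composable_curve hc hXY
    refine ((h.hasVelocity_mul hc hc' hcc').comp (h.mdifferentiableAt_target _)).unique
      ((hc'.comp (h.mdifferentiableAt_target _)).congr ?_)
    filter_upwards [hcc'] with t ht using h.target_mul _ _ ht
  mul_assoc X Y Z hXY hYZ := by
    obtain ⟨c, -, hc⟩ := exists_hasVelocity (n := ∞) X
    obtain ⟨c', hc', hcc'⟩ := h.exists_composable_curve hc hXY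
    obtain ⟨c'', hc'', hcc''⟩ := h.exists_composable_curve hc' hYZ
    have h1 : ∀ᶠ t in 𝓝 0, D.target (D.mul (c t) (c' t)) = D.source (c'' t) := by
      filter_upwards [hcc', hcc''] with t ht ht'
      rw [h.target_mul _ _ ht, ht']
    have h2 : ∀ᶠ t in 𝓝 0, D.target (c t) = D.source (D.mul (c' t) (c'' t)) := by
      filter_upwards [hcc', hcc''] with t ht ht'
      rw [h.source_mul _ _ ht', ht]
    refine (h.hasVelocity_mul (h.hasVelocity_mul hc hc' hcc') hc'' h1).unique
      ((h.hasVelocity_mul hc (h.hasVelocity_mul hc' hc'' hcc'') h2).congr ?_)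
    filter_upwards [hcc', hcc''] with t ht ht' using h.mul_assoc _ _ _ ht ht'
  unit_mul X := by
    obtain ⟨c, -, hc⟩ := exists_hasVelocity (n := ∞) X
    refine (h.hasVelocity_mul ((hc.comp (h.mdifferentiableAt_source _)).comp
      (h.mdifferentiableAt_unit _)) hc (.of_forall fun t => h.target_unit _)).unique
      (hc.congr (.of_forall fun t => h.unit_mul _))
  mul_unit X := by
    obtain ⟨c, -, hc⟩ := exists_hasVelocity (n := ∞) X
    refine (h.hasVelocity_mul hc ((hc.comp (h.mdifferentiableAt_target _)).comp
      (h.mdifferentiableAt_unit _)) (.of_forall fun t => (h.source_unit _).symm)).unique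
      (hc.congr (.of_forall fun t => h.mul_unit _))
  source_inv X := by
    obtain ⟨c, -, hc⟩ := exists_hasVelocity (n := ∞) X
    exact ((hc.comp (h.mdifferentiableAt_inv _)).comp (h.mdifferentiableAt_source _)).unique
      ((hc.comp (h.mdifferentiableAt_target _)).congr (.of_forall fun t => h.source_inv _))
  target_inv X := by
    obtain ⟨c, -, hc⟩ := exists_hasVelocity (n := ∞) X
    exact ((hc.comp (h.mdifferentiableAt_inv _)).comp (h.mdifferentiableAt_target _)).unique
      ((hc.comp (h.mdifferentiableAt_source _)).congr (.of_forall fun t => h.target_inv _))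
  inv_mul X := by
    obtain ⟨c, -, hc⟩ := exists_hasVelocity (n := ∞) X
    exact (h.hasVelocity_mul (hc.comp (h.mdifferentiableAt_inv _)) hc
      (.of_forall fun t => h.target_inv _)).unique
      (((hc.comp (h.mdifferentiableAt_target _)).comp (h.mdifferentiableAt_unit _)).congr
        (.of_forall fun t => h.inv_mul _))
  mul_inv X := by
    obtain ⟨c, -, hc⟩ := exists_hasVelocity (n := ∞) X
    exact (h.hasVelocity_mul hc (hc.comp (h.mdifferentiableAt_inv _))
      (.of_forall fun t => (h.source_inv _).symm)).unique
      (((hc.comp (h.mdifferentiableAt_source _)).comp (h.mdifferentiableAt_unit _)).congr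
        (.of_forall fun t => h.mul_inv _))
  isSubmersion_source := h.isSubmersion_source.isSubmersion_tangentMap
  isSubmersion_target := h.isSubmersion_target.isSubmersion_tangentMap
  contMDiff_source := h.contMDiff_source.contMDiff_tangentMap (by simp)
  contMDiff_target := h.contMDiff_target.contMDiff_tangentMap (by simp)
  contMDiff_unit := h.contMDiff_unit.contMDiff_tangentMap (by simp)
  contMDiff_inv := h.contMDiff_inv.contMDiff_tangentMap (by simp)
  contMDiffOn_mul := h.contMDiffOn_tangent_mul

end GroupoidData.IsLieGroupoid

/-! ### The double tangent bundle and its canonical involution -/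

section DoubleTangent

variable {E H M E' H' M' P : Type*}
  [NormedAddCommGroup E] [NormedSpace ℝ E] [TopologicalSpace H] {I : ModelWithCorners ℝ E H}
  [TopologicalSpace M] [ChartedSpace H M]
  [NormedAddCommGroup E'] [NormedSpace ℝ E'] [TopologicalSpace H'] {I' : ModelWithCorners ℝ E' H'}
  [TopologicalSpace M'] [ChartedSpace H' M'] [NormedAddCommGroup P] [NormedSpace ℝ P]

theorem HasVelocity.hasDerivAt_extChartAt_self [IsManifold I 1 M] {c : ℝ → M} {X : TangentBundle I M}
    (h : HasVelocity I c X) : HasDerivAt (extChartAt I X.1 ∘ c) X.2 0 := by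
  have := h.hasDerivAt_extChartAt (mem_chart_source H X.1)
  rwa [mfderiv_extChartAt_self] at this

/-- A curve that stays in the chart domain is recovered from its coordinates, so its continuity
follows from their differentiability. -/
theorem hasVelocity_of_hasDerivAt_extChartAt' [IsManifold I 1 M] [I.Boundaryless] {c : ℝ → M}
    {X : TangentBundle I M} (hc : ∀ᶠ t in 𝓝 0, c t ∈ (chartAt H X.1).source) (h0 : c 0 = X.1)
    (hd : HasDerivAt (extChartAt I X.1 ∘ c) X.2 0) : HasVelocity I c X := by
  refine hasVelocity_of_hasDerivAt_extChartAt ?_ h0 hd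
  have h1 : ContinuousAt ((extChartAt I X.1).symm ∘ (extChartAt I X.1 ∘ c)) 0 := by
    refine ContinuousAt.comp ?_ hd.continuousAt
    simp only [Function.comp_apply, h0]
    exact continuousAt_extChartAt_symm X.1
  refine h1.congr ?_
  filter_upwards [hc] with t ht
  exact (extChartAt I X.1).left_inv (by rwa [extChartAt_source])

section

variable [IsManifold I 1 M]

theorem extChartAt_tangent_apply {p z : TangentBundle I M} (hz : z.1 ∈ (chartAt H p.1).source) :
    extChartAt I.tangent p z =
      (extChartAt I p.1 z.1, (mfderiv I 𝓘(ℝ, E) (extChartAt I p.1) z.1 z.2 : E)) := by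
  refine Prod.ext rfl ?_
  have h1 := DFunLike.congr_fun (TangentBundle.continuousLinearMapAt_trivializationAt (I := I) hz) z.2
  have h2 : z.1 ∈ (trivializationAt E (TangentSpace I : M → Type _) p.1).baseSet := hz
  rw [Trivialization.continuousLinearMapAt_apply, Trivialization.coe_linearMapAt_of_mem _ h2] at h1
  exact h1

theorem trivializationAt_tangent_snd {x : M} {z : TangentBundle I M}
    (hz : z.1 ∈ (chartAt H x).source) :
    (trivializationAt E (TangentSpace I : M → Type _) x z).2 =
      mfderiv I 𝓘(ℝ, E) (extChartAt I x) z.1 z.2 := by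
  have h1 := DFunLike.congr_fun (TangentBundle.continuousLinearMapAt_trivializationAt (I := I) hz) z.2
  have h2 : z.1 ∈ (trivializationAt E (TangentSpace I : M → Type _) x).baseSet := hz
  rwa [Trivialization.continuousLinearMapAt_apply, Trivialization.coe_linearMapAt_of_mem _ h2] at h1

/-- The preferred chart of `TM` at `p` depends only on the base point of `p`, so one chart serves a
whole fibre, on which its fibre coordinate is the identity. -/
theorem extChartAt_tangent_mk (x : M) (v : TangentSpace I x) (p : TangentBundle I M) (hp : p.1 = x) :
    extChartAt I.tangent p ⟨x, v⟩ = (extChartAt I x x, (v : E)) := by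
  obtain ⟨_, v'⟩ := p
  subst hp
  refine (extChartAt_tangent_apply (z := ⟨_, v⟩) (mem_chart_source H _)).trans ?_
  exact Prod.ext rfl (DFunLike.congr_fun (mfderiv_extChartAt_self (I := I)) v)

end

/-- The velocities `v` of the map `w` along the line spanned by `u`. -/
noncomputable def sweep (I : ModelWithCorners ℝ E H) (w : P → M) (u v : P) (t : ℝ) :
    TangentBundle I M :=
  tangentMap 𝓘(ℝ, P) I w ⟨t • u, v⟩

variable [IsManifold I ∞ M] [IsManifold I' ∞ M']

theorem eventually_extChartAt_sweep {w : P → M} (hw : ContMDiffAt 𝓘(ℝ, P) I 2 w 0) (u v : P)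
    (p : TangentBundle I M) (hp : w 0 ∈ (chartAt H p.1).source) :
    ∀ᶠ t in 𝓝 (0 : ℝ), w (t • u) ∈ (chartAt H p.1).source ∧ extChartAt I.tangent p (sweep I w u v t) =
      (extChartAt I p.1 (w (t • u)), fderiv ℝ (extChartAt I p.1 ∘ w) (t • u) v) := by
  have h1 : ∀ᶠ y in 𝓝 (0 : P), w y ∈ (chartAt H p.1).source ∧ MDifferentiableAt 𝓘(ℝ, P) I w y :=
    Filter.Eventually.and (hw.continuousAt.preimage_mem_nhds ((chartAt H p.1).open_source.mem_nhds hp))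
      (hw.of_le (by norm_num)).eventually_mdifferentiableAt
  have h2 : Filter.Tendsto (fun t : ℝ => t • u) (𝓝 0) (𝓝 0) := by
    have : ContinuousAt (fun t : ℝ => t • u) 0 := by fun_prop
    simpa [ContinuousAt] using this
  filter_upwards [h2.eventually h1] with t ht
  refine ⟨ht.1, ?_⟩
  rw [extChartAt_tangent_apply (z := sweep I w u v t) ht.1]
  refine Prod.ext rfl ?_
  have h3 := mfderiv_comp (t • u) (mdifferentiableAt_extChartAt ht.1) ht.2
  rw [mfderiv_eq_fderiv] at h3
  exact (DFunLike.congr_fun h3 v).symm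

/-- With `F` the coordinate expression of `w`, the sweep reads `t ↦ (F (t u), F' (t u) v)` in the
induced chart; its derivative involves `F''`, hence class `C²`. -/
theorem hasDerivAt_extChartAt_sweep {w : P → M} (hw : ContMDiffAt 𝓘(ℝ, P) I 2 w 0) (u v : P)
    (p : TangentBundle I M) (hp : w 0 ∈ (chartAt H p.1).source) :
    HasDerivAt (extChartAt I.tangent p ∘ sweep I w u v)
      (fderiv ℝ (extChartAt I p.1 ∘ w) 0 u, fderiv ℝ (fderiv ℝ (extChartAt I p.1 ∘ w)) 0 u v) 0 := by
  have hF : ContDiffAt ℝ 2 (extChartAt I p.1 ∘ w) 0 :=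
    ((contMDiffAt_extChartAt' hp).comp 0 hw).contDiffAt
  have h0 : (0 : ℝ) • u = 0 := zero_smul ℝ u
  have hl : HasDerivAt (fun t : ℝ => t • u) u 0 := by
    simpa using (hasDerivAt_id (0 : ℝ)).smul_const u
  have h1 : HasDerivAt (fun t : ℝ => (extChartAt I p.1 ∘ w) (t • u))
      (fderiv ℝ (extChartAt I p.1 ∘ w) 0 u) 0 := by
    refine HasFDerivAt.comp_hasDerivAt (l := extChartAt I p.1 ∘ w) (0 : ℝ) ?_ hl
    rw [h0]
    exact (hF.differentiableAt (by norm_num)).hasFDerivAt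
  have h2 : HasDerivAt (fun t : ℝ => fderiv ℝ (extChartAt I p.1 ∘ w) (t • u))
      (fderiv ℝ (fderiv ℝ (extChartAt I p.1 ∘ w)) 0 u) 0 := by
    refine HasFDerivAt.comp_hasDerivAt (l := fderiv ℝ (extChartAt I p.1 ∘ w)) (0 : ℝ) ?_ hl
    rw [h0]
    exact ((hF.fderiv_right (m := 1) (by norm_num)).differentiableAt (by norm_num)).hasFDerivAt
  have h3 := h2.clm_apply (hasDerivAt_const (0 : ℝ) v)
  simp only [map_zero, add_zero] at h3
  refine (h1.prodMk h3).congr_of_eventuallyEq ?_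
  filter_upwards [eventually_extChartAt_sweep hw u v p hp] with t ht
  exact ht.2

theorem fderiv_fderiv_extChartAt_comm {w : P → M} (hw : ContMDiffAt 𝓘(ℝ, P) I 2 w 0) (u v : P)
    (x : M) (hx : w 0 ∈ (chartAt H x).source) :
    fderiv ℝ (fderiv ℝ (extChartAt I x ∘ w)) 0 u v = fderiv ℝ (fderiv ℝ (extChartAt I x ∘ w)) 0 v u := by
  have hF : ContDiffAt ℝ 2 (extChartAt I x ∘ w) 0 :=
    ((contMDiffAt_extChartAt' hx).comp 0 hw).contDiffAt
  exact (hF.isSymmSndFDerivAt (by simp)).eq u v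

theorem sweep_zero {w : P → M} (hw : ContMDiffAt 𝓘(ℝ, P) I 2 w 0) (u v : P) :
    sweep I w u v 0 = ⟨w 0, fderiv ℝ (extChartAt I (w 0) ∘ w) 0 v⟩ := by
  have h1 := (eventually_extChartAt_sweep hw u v ⟨w 0, 0⟩ (mem_chart_source H _)).self_of_nhds.2
  have h0 : sweep I w u v 0 = ⟨w 0, mfderiv 𝓘(ℝ, P) I w 0 v⟩ := by
    rw [sweep, zero_smul]
    rfl
  rw [h0, extChartAt_tangent_mk _ _ _ rfl] at h1
  have h2 := congrArg Prod.snd h1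
  simp only [zero_smul] at h2
  rw [h0]
  exact congrArg (fun e : E => (⟨w 0, e⟩ : TangentBundle I M)) h2

variable [I.Boundaryless] [I'.Boundaryless]

/-- In the preferred chart at `w 0` the components are `∂ᵥ w`, `∂ᵤ w` and `∂ᵤ∂ᵥ w`. Exchanging `u`
and `v` therefore performs the permutation that defines `canonicalInvolution`. -/
theorem hasVelocity_sweep_fderiv {w : P → M} (hw : ContMDiffAt 𝓘(ℝ, P) I 2 w 0) (u v : P) :
    HasVelocity I.tangent (sweep I w u v)
      ⟨⟨w 0, fderiv ℝ (extChartAt I (w 0) ∘ w) 0 v⟩, ((fderiv ℝ (extChartAt I (w 0) ∘ w) 0 u,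
        fderiv ℝ (fderiv ℝ (extChartAt I (w 0) ∘ w)) 0 u v) : E × E)⟩ := by
  refine hasVelocity_of_hasDerivAt_extChartAt' ?_ (sweep_zero hw u v)
    (hasDerivAt_extChartAt_sweep hw u v ⟨w 0, _⟩ (mem_chart_source H _))
  filter_upwards [eventually_extChartAt_sweep hw u v ⟨w 0, 0⟩ (mem_chart_source H _)] with t ht
  rw [TangentBundle.mem_chart_source_iff]
  exact ht.1

/-- The canonical involution interchanges the two directions of a two-parameter map. -/
theorem exists_hasVelocity_sweep {w : P → M} (hw : ContMDiffAt 𝓘(ℝ, P) I 2 w 0) (u v : P) :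
    ∃ ζ, HasVelocity I.tangent (sweep I w u v) ζ ∧
      HasVelocity I.tangent (sweep I w v u) (canonicalInvolution I ζ) := by
  refine ⟨_, hasVelocity_sweep_fderiv hw u v, ?_⟩
  have h1 := hasVelocity_sweep_fderiv hw v u
  rw [fderiv_fderiv_extChartAt_comm hw v u _ (mem_chart_source H _)] at h1
  exact h1

theorem HasVelocity.sweep_swap {w : P → M} (hw : ContMDiffAt 𝓘(ℝ, P) I 2 w 0) {u v : P} {ζ}
    (h : HasVelocity I.tangent (sweep I w u v) ζ) :
    HasVelocity I.tangent (sweep I w v u) (canonicalInvolution I ζ) := by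
  obtain ⟨ζ', h1, h2⟩ := exists_hasVelocity_sweep hw u v
  rwa [h.unique h1]

/-- For `ζ = (x, v; a, b)` the map is `φ x + s₁ a + s₂ v + s₁ s₂ b` in the chart `φ` at `x`: its
first derivatives at `0` are `a` and `v`, and its mixed derivative is `b`. Statements about `κ`
thereby become statements about two-parameter maps. -/
theorem exists_sweep (ζ : TangentBundle I.tangent (TangentBundle I M)) :
    ∃ w : ℝ × ℝ → M, ContMDiffAt 𝓘(ℝ, ℝ × ℝ) I 2 w 0 ∧
      HasVelocity I.tangent (sweep I w (1, 0) (0, 1)) ζ := by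
  obtain ⟨⟨x, v⟩, ab⟩ := ζ
  let v' : E := v
  let a : E := (show E × E from ab).1
  let b : E := (show E × E from ab).2
  let φ := extChartAt I x
  let l : ℝ × ℝ → E := fun s => φ x + (s.1 • a + s.2 • (v' + s.1 • b))
  have hl : ContDiff ℝ 2 l := by fun_prop
  have hl0 : l 0 = φ x := by simp [l]
  have hs : ContMDiffAt 𝓘(ℝ, E) I 2 φ.symm (l 0) := by
    have := contMDiffWithinAt_extChartAt_symm_range (I := I) (n := 2) x
      (mem_extChartAt_target (I := I) x)
    rw [I.range_eq_univ, contMDiffWithinAt_univ] at this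
    rwa [hl0]
  have hw : ContMDiffAt 𝓘(ℝ, ℝ × ℝ) I 2 (φ.symm ∘ l) 0 := hs.comp 0 hl.contMDiff.contMDiffAt
  have hw0 : (φ.symm ∘ l) 0 = x := by
    rw [Function.comp_apply, hl0]
    exact extChartAt_to_inv x
  have hF : φ ∘ (φ.symm ∘ l) =ᶠ[𝓝 0] l := by
    have h2 : l ⁻¹' φ.target ∈ 𝓝 0 :=
      hl.continuous.continuousAt.preimage_mem_nhds (by rw [hl0]; exact extChartAt_target_mem_nhds x)
    filter_upwards [h2] with t ht
    exact φ.right_inv ht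
  have hl1 : ∀ s, HasFDerivAt l (((ContinuousLinearMap.fst ℝ ℝ ℝ).smulRight a) +
      ((s.2 • (ContinuousLinearMap.fst ℝ ℝ ℝ).smulRight b) +
        (ContinuousLinearMap.snd ℝ ℝ ℝ).smulRight (v' + s.1 • b))) s := by
    intro s
    have h1 : HasFDerivAt (fun s : ℝ × ℝ => s.1) (ContinuousLinearMap.fst ℝ ℝ ℝ) s := hasFDerivAt_fst
    have h2 : HasFDerivAt (fun s : ℝ × ℝ => s.2) (ContinuousLinearMap.snd ℝ ℝ ℝ) s := hasFDerivAt_snd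
    exact (((h1.smul_const a).add (h2.smul ((h1.smul_const b).const_add v'))).const_add (φ x))
  have hl2 : ∀ s, fderiv ℝ l s (0, 1) = v' + s.1 • b := by
    intro s
    rw [(hl1 s).fderiv]
    simp
  have hl3 : fderiv ℝ l 0 (1, 0) = a := by
    rw [(hl1 0).fderiv]
    simp
  have hl4 : fderiv ℝ (fderiv ℝ l) 0 (1, 0) (0, 1) = b := by
    have h1 : HasFDerivAt (fun s => fderiv ℝ l s (0, 1)) ((ContinuousLinearMap.fst ℝ ℝ ℝ).smulRight b)
        0 := by
      simp only [hl2]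
      exact ((hasFDerivAt_fst (𝕜 := ℝ) (E := ℝ) (F := ℝ)).smul_const b).const_add v'
    have h2 : HasFDerivAt (fderiv ℝ l) (fderiv ℝ (fderiv ℝ l) 0) 0 :=
      ((hl.contDiffAt.fderiv_right (m := 1) (by norm_num)).differentiableAt (by norm_num)).hasFDerivAt
    have h3 := h1.unique (h2.clm_apply (hasFDerivAt_const ((0, 1) : ℝ × ℝ) 0))
    have h4 := DFunLike.congr_fun h3 ((1, 0) : ℝ × ℝ)
    simpa using h4.symm
  refine ⟨φ.symm ∘ l, hw, ?_⟩
  have h1 := hasVelocity_sweep_fderiv hw ((1, 0) : ℝ × ℝ) ((0, 1) : ℝ × ℝ)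
  rw [hw0] at h1
  have h2 : fderiv ℝ (extChartAt I x ∘ (φ.symm ∘ l)) =ᶠ[𝓝 0] fderiv ℝ l := hF.fderiv
  rw [h2.eq_of_nhds, h2.fderiv_eq, hl4, hl3, hl2] at h1
  have h5 : v' + (0 : ℝ × ℝ).1 • b = v' := by simp
  rw [h5] at h1
  exact h1

/-- The canonical involution is natural. -/
theorem canonicalInvolution_tangentMap {f : M → M'} (hf : ContMDiff I I' ∞ f)
    (ζ : TangentBundle I.tangent (TangentBundle I M)) :
    canonicalInvolution I' (tangentMap I.tangent I'.tangent (tangentMap I I' f) ζ) =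
      tangentMap I.tangent I'.tangent (tangentMap I I' f) (canonicalInvolution I ζ) := by
  obtain ⟨w, hw, hζ⟩ := exists_sweep ζ
  have hf1 : ∀ y, MDifferentiableAt I I' f y := fun y => (hf y).mdifferentiableAt (by simp)
  have hf2 : ∀ y, MDifferentiableAt I.tangent I'.tangent (tangentMap I I' f) y := fun y =>
    ((hf.contMDiff_tangentMap (m := ∞) (by simp)) y).mdifferentiableAt (by simp)
  have hfw : ContMDiffAt 𝓘(ℝ, ℝ × ℝ) I' 2 (f ∘ w) 0 := ((hf.of_le ENat.LEInfty.out) _).comp 0 hw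
  -- Sweeping commutes with `f` by the chain rule, so the parameters may be exchanged before or
  -- after applying `f`.
  have h1 : ∀ u v : ℝ × ℝ, sweep I' (f ∘ w) u v =ᶠ[𝓝 0] tangentMap I I' f ∘ sweep I w u v := by
    intro u v
    have h2 : Filter.Tendsto (fun t : ℝ => t • u) (𝓝 0) (𝓝 0) := by
      have : ContinuousAt (fun t : ℝ => t • u) 0 := by fun_prop
      simpa [ContinuousAt] using this
    filter_upwards [h2.eventually (hw.of_le (by norm_num)).eventually_mdifferentiableAt] with t ht
    exact tangentMap_comp_at _ (hf1 _) ht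
  have h3 := ((hζ.comp (hf2 _)).congr (h1 _ _)).sweep_swap hfw
  exact h3.unique (((hζ.sweep_swap hw).comp (hf2 _)).congr (h1 _ _))

end DoubleTangent

/-! ### The canonical involution: projections, coordinate expressions, smoothness -/

section CanonicalInvolution

variable {E H M : Type*}
  [NormedAddCommGroup E] [NormedSpace ℝ E] [TopologicalSpace H] {I : ModelWithCorners ℝ E H}
  [TopologicalSpace M] [ChartedSpace H M] [IsManifold I ∞ M]

theorem canonicalInvolution_canonicalInvolution (ζ : TangentBundle I.tangent (TangentBundle I M)) :
    canonicalInvolution I (canonicalInvolution I ζ) = ζ := rfl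

/-- The canonical involution interchanges the zero section of `TTM → TM` with the tangent map of the
zero section of `TM → M`. -/
theorem canonicalInvolution_tangentMap_zeroSection (X : TangentBundle I M) :
    canonicalInvolution I (tangentMap I I.tangent (zeroSection E (TangentSpace I)) X) = ⟨X, 0⟩ := by
  rw [TangentBundle.tangentMap_tangentBundle_pure]
  rfl

theorem contMDiff_tangentBundle_proj :
    ContMDiff I.tangent I ∞ (π E (TangentSpace I : M → Type _)) :=
  contMDiff_proj (TangentSpace I)

theorem mdifferentiableAt_tangentBundle_proj (X : TangentBundle I M) :
    MDifferentiableAt I.tangent I (π E (TangentSpace I : M → Type _)) X :=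
  (contMDiff_tangentBundle_proj X).mdifferentiableAt (by simp)

variable [I.Boundaryless]

/-- For a curve in `TM` with velocity `ζ`, the first component of the velocity in the induced chart
is the velocity of the base curve, and `κ` moves this component to the base point. -/
theorem tangentMap_tangentBundle_proj (ζ : TangentBundle I.tangent (TangentBundle I M)) :
    tangentMap I.tangent I (π E (TangentSpace I)) ζ = (canonicalInvolution I ζ).1 := by
  obtain ⟨c, -, hc⟩ := exists_hasVelocity (n := ∞) ζ
  have h1 := (hc.comp (mdifferentiableAt_tangentBundle_proj _)).hasDerivAt_extChartAt_self
  have h2 := ((ContinuousLinearMap.fst ℝ E E).hasFDerivAt).comp_hasDerivAt (0 : ℝ)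
    hc.hasDerivAt_extChartAt_self
  exact congrArg (fun e : E => (⟨ζ.1.1, e⟩ : TangentBundle I M)) (h1.unique h2)

/-- The definition of `κ` uses a chart that moves with `ζ`, so smoothness cannot be read off from
it. Here the coordinate formula is obtained in the chart at a fixed `p`: derivatives of a sweep have
the same form in every chart, and second derivatives are symmetric in each. -/
theorem mfderiv_extChartAt_canonicalInvolution {p : TangentBundle I M}
    {ζ : TangentBundle I.tangent (TangentBundle I M)} (hp : ζ.1.1 ∈ (chartAt H p.1).source) :
    (mfderiv I.tangent 𝓘(ℝ, E × E) (extChartAt I.tangent p) (canonicalInvolution I ζ).1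
      (canonicalInvolution I ζ).2 : E × E) =
    ((extChartAt I.tangent p ζ.1).2,
      (mfderiv I.tangent 𝓘(ℝ, E × E) (extChartAt I.tangent p) ζ.1 ζ.2 : E × E).2) := by
  obtain ⟨w, hw, hζ⟩ := exists_sweep ζ
  have hζ' := hζ.sweep_swap hw
  have h0 : w 0 = ζ.1.1 := by
    have := congrArg TotalSpace.proj hζ.apply_zero
    rw [sweep, zero_smul] at this
    exact this
  have hw0 : w 0 ∈ (chartAt H p.1).source := by rwa [h0]
  have h1 := hζ.hasDerivAt_extChartAt (p := p) (by rwa [TangentBundle.mem_chart_source_iff])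
  have h2 := hζ'.hasDerivAt_extChartAt (p := p) (by rwa [TangentBundle.mem_chart_source_iff])
  have e1 := h1.unique (hasDerivAt_extChartAt_sweep hw _ _ p hw0)
  have e2 := h2.unique (hasDerivAt_extChartAt_sweep hw _ _ p hw0)
  have e3 := (eventually_extChartAt_sweep hw (1, 0) (0, 1) p hw0).self_of_nhds.2
  rw [hζ.apply_zero, zero_smul] at e3
  rw [fderiv_fderiv_extChartAt_comm hw _ _ _ hw0] at e2
  refine e2.trans (Prod.ext ?_ ?_)
  · exact (congrArg Prod.snd e3).symm
  · exact (congrArg Prod.snd e1).symm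

theorem contMDiff_canonicalInvolution :
    ContMDiff I.tangent.tangent I.tangent.tangent ∞
      (canonicalInvolution I : TangentBundle I.tangent (TangentBundle I M) → _) := by
  intro ζ₀
  rw [contMDiffAt_totalSpace]
  constructor
  · have h1 : ContMDiff I.tangent.tangent I.tangent ∞
        (tangentMap I.tangent I (π E (TangentSpace I : M → Type _))) :=
      contMDiff_tangentBundle_proj.contMDiff_tangentMap (by simp)
    refine (h1 ζ₀).congr_of_eventuallyEq (.of_forall fun ζ => ?_)
    exact (tangentMap_tangentBundle_proj ζ).symm
  · have hπ : ContMDiffAt I.tangent.tangent I.tangent ∞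
        (π (E × E) (TangentSpace I.tangent : TangentBundle I M → Type _)) ζ₀ :=
      contMDiff_tangentBundle_proj ζ₀
    have h1 : ContMDiffAt I.tangent.tangent 𝓘(ℝ, E × E) ∞
        (fun ζ : TangentBundle I.tangent (TangentBundle I M) => extChartAt I.tangent ζ₀.1 ζ.1) ζ₀ :=
      (contMDiffAt_extChartAt (I := I.tangent) (x := ζ₀.1)).comp ζ₀ hπ
    have h2 := ((contMDiffAt_totalSpace (IB := I.tangent) (n := ∞) (F := E × E)
      (E := (TangentSpace I.tangent : TangentBundle I M → Type _)) (f := id) (x₀ := ζ₀)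
      (IM := I.tangent.tangent)).1 contMDiffAt_id).2
    have h3 := ((ContinuousLinearMap.snd ℝ E E).contMDiff.contMDiffAt.comp ζ₀ h1).prodMk_space
      ((ContinuousLinearMap.snd ℝ E E).contMDiff.contMDiffAt.comp ζ₀ h2)
    refine h3.congr_of_eventuallyEq ?_
    have h4 : ∀ᶠ ζ : TangentBundle I.tangent (TangentBundle I M) in 𝓝 ζ₀,
        ζ.1 ∈ (chartAt (ModelProd H E) ζ₀.1).source :=
      hπ.continuousAt.preimage_mem_nhds ((chartAt (ModelProd H E) ζ₀.1).open_source.mem_nhds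
        (mem_chart_source _ _))
    filter_upwards [h4] with ζ hζ
    have hζ' : ζ.1.1 ∈ (chartAt H ζ₀.1.1).source := by
      rwa [TangentBundle.mem_chart_source_iff] at hζ
    have hζ'' : (canonicalInvolution I ζ).1 ∈
        (chartAt (ModelProd H E) (canonicalInvolution I ζ₀).1).source := by
      rw [TangentBundle.mem_chart_source_iff]
      exact hζ'
    have e1 := trivializationAt_tangent_snd hζ''
    have e2 := trivializationAt_tangent_snd hζ
    refine (e1.trans (mfderiv_extChartAt_canonicalInvolution (p := (canonicalInvolution I ζ₀).1) hζ')).trans ?_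
    -- `ζ₀.1` and the base point of `κ ζ₀` lie over the same point of `M`, so the charts of `TM` at
    -- the two coincide.
    refine Prod.ext rfl ?_
    exact (congrArg (fun e : E × E => e.2) e2).symm

/-- The velocity of a line in the fibre `T_x M`. -/
theorem hasVelocity_vertical (x : M) (v b : E) :
    HasVelocity I.tangent (fun t : ℝ => (⟨x, v + t • b⟩ : TangentBundle I M))
      ⟨⟨x, v⟩, ((0, b) : E × E)⟩ := by
  refine hasVelocity_of_hasDerivAt_extChartAt' (.of_forall fun t => ?_) ?_ ?_
  · rw [TangentBundle.mem_chart_source_iff]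
    exact mem_chart_source H x
  · exact congrArg (fun e : E => (⟨x, e⟩ : TangentBundle I M)) (by simp)
  · have h1 : HasDerivAt (fun t : ℝ => (extChartAt I x x, v + t • b)) ((0, b) : E × E) 0 := by
      refine (hasDerivAt_const (0 : ℝ) _).prodMk ?_
      simpa using ((hasDerivAt_id (0 : ℝ)).smul_const b).const_add v
    refine h1.congr_of_eventuallyEq (.of_forall fun t => ?_)
    exact extChartAt_tangent_mk x _ ⟨x, v⟩ rfl

end CanonicalInvolution

/-! ### Differentiating fibrewise sums and multiples -/

/-- `Z` is the sum of the elements `X` and `Y` of the same fibre of a bundle. -/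
def Bundle.IsFiberSum {B F : Type*} {E : B → Type*} [∀ b, Add (E b)] (X Y Z : TotalSpace F E) : Prop :=
  ∃ (b : B) (v w : E b), X = ⟨b, v⟩ ∧ Y = ⟨b, w⟩ ∧ Z = ⟨b, v + w⟩

section FiberSum

variable {E H M : Type*}
  [NormedAddCommGroup E] [NormedSpace ℝ E] [TopologicalSpace H] {I : ModelWithCorners ℝ E H}
  [TopologicalSpace M] [ChartedSpace H M] [IsManifold I ∞ M]

theorem HasVelocity.eventually_mem_chart {c : ℝ → TangentBundle I M}
    {ζ : TangentBundle I.tangent (TangentBundle I M)} (h : HasVelocity I.tangent c ζ) :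
    ∀ᶠ t in 𝓝 0, (c t).1 ∈ (chartAt H ζ.1.1).source := by
  have := h.continuousAt.preimage_mem_nhds ((chartAt (ModelProd H E) ζ.1).open_source.mem_nhds
    (by rw [h.apply_zero]; exact mem_chart_source _ _))
  filter_upwards [this] with t ht
  rwa [mem_preimage, TangentBundle.mem_chart_source_iff] at ht

/-- Velocities of curves in `TM` over the same curve in `M` add up after applying the canonical
involution. -/
theorem HasVelocity.isFiberSum {c₁ c₂ c₃ : ℝ → TangentBundle I M}
    {ζ₁ ζ₂ ζ₃ : TangentBundle I.tangent (TangentBundle I M)} (h₁ : HasVelocity I.tangent c₁ ζ₁)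
    (h₂ : HasVelocity I.tangent c₂ ζ₂) (h₃ : HasVelocity I.tangent c₃ ζ₃)
    (h : ∀ᶠ t in 𝓝 0, IsFiberSum (c₁ t) (c₂ t) (c₃ t)) :
    IsFiberSum (canonicalInvolution I ζ₁) (canonicalInvolution I ζ₂) (canonicalInvolution I ζ₃) := by
  obtain ⟨x, v₁, v₂, e₁, e₂, e₃⟩ := h.self_of_nhds
  rw [h₁.apply_zero] at e₁
  rw [h₂.apply_zero] at e₂
  rw [h₃.apply_zero] at e₃
  obtain ⟨p₁, a₁⟩ := ζ₁
  obtain ⟨p₂, a₂⟩ := ζ₂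
  obtain ⟨p₃, a₃⟩ := ζ₃
  dsimp only at e₁ e₂ e₃
  subst e₁ e₂ e₃
  have d₁ := h₁.hasDerivAt_extChartAt_self
  have d₂ := h₂.hasDerivAt_extChartAt_self
  have d₃ := h₃.hasDerivAt_extChartAt_self
  -- The three charts are one chart, linear on fibres: base coordinates of the curves agree and
  -- fibre coordinates add, and both relations are differentiated.
  have key : ∀ᶠ t in 𝓝 0,
      (extChartAt I.tangent (⟨x, v₂⟩ : TangentBundle I M) (c₂ t)).1 =
        (extChartAt I.tangent (⟨x, v₁⟩ : TangentBundle I M) (c₁ t)).1 ∧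
      (extChartAt I.tangent (⟨x, v₁ + v₂⟩ : TangentBundle I M) (c₃ t)).1 =
        (extChartAt I.tangent (⟨x, v₁⟩ : TangentBundle I M) (c₁ t)).1 ∧
      (extChartAt I.tangent (⟨x, v₁ + v₂⟩ : TangentBundle I M) (c₃ t)).2 =
        (extChartAt I.tangent (⟨x, v₁⟩ : TangentBundle I M) (c₁ t)).2 +
          (extChartAt I.tangent (⟨x, v₂⟩ : TangentBundle I M) (c₂ t)).2 := by
    filter_upwards [h, h₁.eventually_mem_chart] with t ⟨y, w₁, w₂, k₁, k₂, k₃⟩ hy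
    rw [k₁] at hy
    have hy : y ∈ (chartAt H x).source := hy
    rw [k₁, k₂, k₃, extChartAt_tangent_apply (z := ⟨y, w₁⟩) hy,
      extChartAt_tangent_apply (z := ⟨y, w₂⟩) hy, extChartAt_tangent_apply (z := ⟨y, w₁ + w₂⟩) hy]
    exact ⟨rfl, rfl, map_add (mfderiv I 𝓘(ℝ, E) (extChartAt I x) y) w₁ w₂⟩
  let p : E × E →L[ℝ] E := ContinuousLinearMap.fst ℝ E E
  let q : E × E →L[ℝ] E := ContinuousLinearMap.snd ℝ E E
  have f₁ := (p.hasFDerivAt.comp_hasDerivAt (0 : ℝ) d₁)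
  have f₂ := (p.hasFDerivAt.comp_hasDerivAt (0 : ℝ) d₂)
  have f₃ := (p.hasFDerivAt.comp_hasDerivAt (0 : ℝ) d₃)
  have g₁ := (q.hasFDerivAt.comp_hasDerivAt (0 : ℝ) d₁)
  have g₂ := (q.hasFDerivAt.comp_hasDerivAt (0 : ℝ) d₂)
  have g₃ := (q.hasFDerivAt.comp_hasDerivAt (0 : ℝ) d₃)
  have r₁ := f₂.unique (f₁.congr_of_eventuallyEq (by filter_upwards [key] with t ht using ht.1))
  have r₂ := f₃.unique (f₁.congr_of_eventuallyEq (by filter_upwards [key] with t ht using ht.2.1))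
  have r₃ := g₃.unique ((g₁.add g₂).congr_of_eventuallyEq
    (by filter_upwards [key] with t ht using ht.2.2))
  have s : ∀ (a b : E) (w : E × E), a = b → (⟨⟨x, a⟩, w⟩ : TangentBundle I.tangent (TangentBundle I M)) =
      ⟨⟨x, b⟩, w⟩ := by rintro a _ w rfl; rfl
  -- After `κ` the common base point is the velocity of the common base curve, and both remaining
  -- components are added.
  refine ⟨⟨x, (show E × E from a₁).1⟩, ((v₁, (show E × E from a₁).2) : E × E),
    ((v₂, (show E × E from a₂).2) : E × E), rfl, s _ _ _ r₁, ?_⟩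
  refine (s _ _ _ r₂).trans ?_
  exact congrArg (fun e : E => (⟨⟨x, (show E × E from a₁).1⟩, ((v₁ + v₂, e) : E × E)⟩ :
    TangentBundle I.tangent (TangentBundle I M))) r₃

/-- Scaling of a curve in `TM` scales the velocity after applying the canonical involution. -/
theorem HasVelocity.fiber_smul {c₁ c₂ : ℝ → TangentBundle I M} {s : ℝ}
    {ζ₁ ζ₂ : TangentBundle I.tangent (TangentBundle I M)} (h₁ : HasVelocity I.tangent c₁ ζ₁)
    (h₂ : HasVelocity I.tangent c₂ ζ₂) (h : ∀ t, c₂ t = ⟨(c₁ t).1, s • (c₁ t).2⟩) :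
    canonicalInvolution I ζ₂ = ⟨(canonicalInvolution I ζ₁).1, s • (canonicalInvolution I ζ₁).2⟩ := by
  have e₂ := h 0
  rw [h₁.apply_zero, h₂.apply_zero] at e₂
  obtain ⟨⟨x, v₁⟩, a₁⟩ := ζ₁
  obtain ⟨p₂, a₂⟩ := ζ₂
  dsimp only at e₂
  subst e₂
  have d₁ := h₁.hasDerivAt_extChartAt_self
  have d₂ := h₂.hasDerivAt_extChartAt_self
  have key : ∀ᶠ t in 𝓝 0,
      (extChartAt I.tangent (⟨x, s • v₁⟩ : TangentBundle I M) (c₂ t)).1 =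
        (extChartAt I.tangent (⟨x, v₁⟩ : TangentBundle I M) (c₁ t)).1 ∧
      (extChartAt I.tangent (⟨x, s • v₁⟩ : TangentBundle I M) (c₂ t)).2 =
        s • (extChartAt I.tangent (⟨x, v₁⟩ : TangentBundle I M) (c₁ t)).2 := by
    filter_upwards [h₁.eventually_mem_chart] with t hy
    rw [h t, extChartAt_tangent_apply (p := ⟨x, v₁⟩) hy,
      extChartAt_tangent_apply (p := ⟨x, s • v₁⟩) (z := ⟨(c₁ t).1, s • (c₁ t).2⟩) hy]
    exact ⟨rfl, map_smul (mfderiv I 𝓘(ℝ, E) (extChartAt I x) (c₁ t).1) s (c₁ t).2⟩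
  let p : E × E →L[ℝ] E := ContinuousLinearMap.fst ℝ E E
  let q : E × E →L[ℝ] E := ContinuousLinearMap.snd ℝ E E
  have f₁ := (p.hasFDerivAt.comp_hasDerivAt (0 : ℝ) d₁)
  have f₂ := (p.hasFDerivAt.comp_hasDerivAt (0 : ℝ) d₂)
  have g₁ := (q.hasFDerivAt.comp_hasDerivAt (0 : ℝ) d₁)
  have g₂ := (q.hasFDerivAt.comp_hasDerivAt (0 : ℝ) d₂)
  have r₁ := f₂.unique (f₁.congr_of_eventuallyEq (by filter_upwards [key] with t ht using ht.1))
  have r₂ := g₂.unique ((g₁.const_smul s).congr_of_eventuallyEq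
    (by filter_upwards [key] with t ht using ht.2))
  have k : ∀ (a b : E) (w : E × E), a = b → (⟨⟨x, a⟩, w⟩ : TangentBundle I.tangent (TangentBundle I M)) =
      ⟨⟨x, b⟩, w⟩ := by rintro a _ w rfl; rfl
  refine (k _ _ _ r₁).trans ?_
  exact congrArg (fun e : E => (⟨⟨x, (show E × E from a₁).1⟩, ((s • v₁, e) : E × E)⟩ :
    TangentBundle I.tangent (TangentBundle I M))) r₂

end FiberSum

set_option linter.unusedSectionVars false

/-! ### The Lie algebroid of the tangent groupoid -/

namespace GroupoidData.IsLieGroupoid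

variable {EG HG G EQ HQ Q : Type*}
  [NormedAddCommGroup EG] [NormedSpace ℝ EG] [FiniteDimensional ℝ EG] [TopologicalSpace HG]
  [NormedAddCommGroup EQ] [NormedSpace ℝ EQ] [FiniteDimensional ℝ EQ] [TopologicalSpace HQ]
  {IG : ModelWithCorners ℝ EG HG} [IG.Boundaryless]
  {IQ : ModelWithCorners ℝ EQ HQ} [IQ.Boundaryless]
  [TopologicalSpace G] [ChartedSpace HG G] [IsManifold IG ∞ G]
  [TopologicalSpace Q] [ChartedSpace HQ Q] [IsManifold IQ ∞ Q]
  {D : GroupoidData G Q} (h : D.IsLieGroupoid IG IQ)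

local notation "AF" => AlgebroidModelFiber EG EQ
local notation "IA" => ModelWithCorners.prod IQ 𝓘(ℝ, AlgebroidModelFiber EG EQ)

/-! ### `AG` as a submanifold of `TG`: equations, fibre coordinate and local retractions -/

theorem inclusion_injective : Function.Injective h.inclusion := by
  rintro ⟨q, v⟩ ⟨q', v'⟩ hvv
  have h1 : D.unit q = D.unit q' := congrArg TotalSpace.proj hvv
  have h2 : q = q' := by rw [← h.source_unit q, h1, h.source_unit]
  subst h2
  have h3 : Algebroid.toTangent h q v = Algebroid.toTangent h q v' :=
    eq_of_heq (TotalSpace.mk.inj hvv).2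
  rw [Algebroid.toTangent_injective h q h3]

theorem tangentMap_source_inclusion (p : h.AlgebroidSpace) :
    tangentMap IG IQ D.source (h.inclusion p) = zeroSection EQ (TangentSpace IQ) p.1 := by
  have h1 : ∀ (q q' : Q) (w : EQ), q = q' → (⟨q, w⟩ : TangentBundle IQ Q) = ⟨q', w⟩ := by
    rintro q _ w rfl
    rfl
  have h2 : tangentMap IG IQ D.source (h.inclusion p) = ⟨D.source (D.unit p.1), (0 : EQ)⟩ :=
    congrArg (fun e : EQ => (⟨D.source (D.unit p.1), e⟩ : TangentBundle IQ Q))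
      (Algebroid.mfderiv_toTangent h p.1 p.2)
  rw [h2]
  exact h1 _ _ _ (h.source_unit _)

/-- Together with `tangentMap_source_inclusion` this describes `AG` by equations in `TG`. Equality
in the total space `TQ` avoids transport along `α (ε q) = q`. -/
theorem exists_inclusion_eq {Z : TangentBundle IG G} {q : Q} (hq : Z.1 = D.unit q)
    (hZ : tangentMap IG IQ D.source Z = zeroSection EQ (TangentSpace IQ) q) :
    ∃ v : Algebroid h q, h.inclusion ⟨q, v⟩ = Z := by
  obtain ⟨g, v⟩ := Z
  dsimp only at hq
  subst hq
  have h1 : ∀ (q q' : Q) (w w' : EQ), (⟨q, w⟩ : TangentBundle IQ Q) = ⟨q', w'⟩ → w = w' := by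
    intro q q' w w' hw
    obtain ⟨rfl, h2⟩ := TotalSpace.mk.inj hw
    exact eq_of_heq h2
  exact ⟨Algebroid.mk h q v (h1 _ _ _ _ hZ), rfl⟩

/-- The coordinate of a tangent vector of `G` that restricts to the fibre coordinate of `AG`. -/
noncomputable def fiberCoord (q₀ : Q) (Z : TangentBundle IG G) : AF :=
  h.compl q₀ (trivializationAt EG (TangentSpace IG) (D.unit q₀) Z).2

theorem fiberCoord_inclusion {q₀ : Q} {p : h.AlgebroidSpace} (hp : p.1 ∈ h.trivSet q₀) :
    h.fiberCoord q₀ (h.inclusion p) = (trivializationAt AF (Algebroid h) q₀ p).2 := by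
  rw [fiberCoord, trivializationAt_tangent_snd (z := h.inclusion p) hp.1.1]
  rfl

/-- The fibre coordinate of `AG` is the restriction of the smooth function `fiberCoord` on an open
part of `TG`, so smoothness into `AG` can be tested in `TG`. -/
theorem contMDiffAt_of_inclusion {E' H' M' : Type*} [NormedAddCommGroup E'] [NormedSpace ℝ E']
    [TopologicalSpace H'] {I' : ModelWithCorners ℝ E' H'} [TopologicalSpace M'] [ChartedSpace H' M']
    {f : M' → h.AlgebroidSpace} {x : M'} (h1 : ContMDiffAt I' IQ ∞ (fun y => (f y).1) x)
    (h2 : ContMDiffAt I' IG.tangent ∞ (fun y => h.inclusion (f y)) x) : ContMDiffAt I' IA ∞ f x := by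
  rw [contMDiffAt_totalSpace] at h2 ⊢
  refine ⟨h1, ?_⟩
  have h3 : ContMDiffAt I' 𝓘(ℝ, AF) ∞ (fun y => h.fiberCoord (f x).1 (h.inclusion (f y))) x :=
    (h.compl (f x).1).contMDiff.contMDiffAt.comp x h2.2
  refine h3.congr_of_eventuallyEq ?_
  filter_upwards [h1.continuousAt.preimage_mem_nhds
    ((h.isOpen_trivSet (f x).1).mem_nhds (h.mem_trivSet (f x).1))] with y hy
  exact (h.fiberCoord_inclusion hy).symm

/-- A local left inverse of the inclusion `AG → TG`. -/
noncomputable def retraction (q₀ : Q) (Z : TangentBundle IG G) : h.AlgebroidSpace :=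
  (trivializationAt AF (Algebroid h) q₀).toOpenPartialHomeomorph.symm
    (D.source Z.1, h.fiberCoord q₀ Z)

/-- The domain of the local left inverse of the inclusion `AG → TG`. -/
def retractionSet (q₀ : Q) : Set (TangentBundle IG G) :=
  {Z | Z.1 ∈ (chartAt HG (D.unit q₀)).source ∧ D.source Z.1 ∈ h.trivSet q₀}

theorem isOpen_retractionSet (q₀ : Q) : IsOpen (h.retractionSet q₀) := by
  have h1 := FiberBundle.continuous_proj EG (TangentSpace IG : G → Type _)
  exact ((chartAt HG (D.unit q₀)).open_source.preimage h1).inter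
    ((h.isOpen_trivSet q₀).preimage (h.contMDiff_source.continuous.comp h1))

theorem inclusion_mem_retractionSet {q₀ : Q} {p : h.AlgebroidSpace} (hp : p.1 ∈ h.trivSet q₀) :
    h.inclusion p ∈ h.retractionSet q₀ := by
  refine ⟨hp.1.1, ?_⟩
  change D.source (D.unit p.1) ∈ _
  rwa [h.source_unit]

theorem retraction_inclusion {q₀ : Q} {p : h.AlgebroidSpace} (hp : p.1 ∈ h.trivSet q₀) :
    h.retraction q₀ (h.inclusion p) = p := by
  have h1 : D.source (h.inclusion p).1 = p.1 := h.source_unit p.1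
  rw [retraction, h1, h.fiberCoord_inclusion hp]
  exact (trivializationAt AF (Algebroid h) q₀).symm_apply_mk_proj
    ((trivializationAt AF (Algebroid h) q₀).mem_source.2 hp)

theorem trivializationAt_retraction {q₀ : Q} {Z : TangentBundle IG G} (hZ : Z ∈ h.retractionSet q₀) :
    trivializationAt AF (Algebroid h) q₀ (h.retraction q₀ Z) = (D.source Z.1, h.fiberCoord q₀ Z) :=
  (trivializationAt AF (Algebroid h) q₀).apply_symm_apply' hZ.2

theorem retraction_proj {q₀ : Q} {Z : TangentBundle IG G} (hZ : Z ∈ h.retractionSet q₀) :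
    (h.retraction q₀ Z).1 = D.source Z.1 :=
  congrArg Prod.fst (h.trivializationAt_retraction hZ)

theorem contMDiffOn_fiberCoord (q₀ : Q) :
    ContMDiffOn IG.tangent 𝓘(ℝ, AF) ∞ (h.fiberCoord q₀)
      (π EG (TangentSpace IG) ⁻¹' (chartAt HG (D.unit q₀)).source) := by
  have h1 := (trivializationAt EG (TangentSpace IG : G → Type _) (D.unit q₀)).contMDiffOn
    (IB := IG) (n := ∞)
  exact (h.compl q₀).contMDiff.comp_contMDiffOn (contMDiff_snd.comp_contMDiffOn h1)

theorem contMDiffOn_retraction (q₀ : Q) :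
    ContMDiffOn IG.tangent IA ∞ (h.retraction q₀) (h.retractionSet q₀) := by
  have h1 := (trivializationAt AF (Algebroid h) q₀).contMDiffOn_symm (IB := IQ) (n := ∞)
  refine h1.comp (ContMDiffOn.prodMk ?_ ((h.contMDiffOn_fiberCoord q₀).mono fun Z hZ => hZ.1)) ?_
  · exact (h.contMDiff_source.comp contMDiff_tangentBundle_proj).contMDiffOn
  · intro Z hZ
    rw [Trivialization.target_eq]
    exact ⟨hZ.2, mem_univ _⟩

theorem mdifferentiableAt_inclusion (p : h.AlgebroidSpace) :
    MDifferentiableAt IA IG.tangent h.inclusion p :=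
  (h.contMDiff_inclusion p).mdifferentiableAt (by simp)

theorem mdifferentiableAt_algebroid_proj (p : h.AlgebroidSpace) :
    MDifferentiableAt IA IQ (π AF (Algebroid h)) p :=
  (contMDiffAt_proj (n := ∞) (Algebroid h)).mdifferentiableAt (by simp)

include h in
theorem mdifferentiableAt_tangent_source (X : TangentBundle IG G) :
    MDifferentiableAt IG.tangent IQ.tangent (tangentMap IG IQ D.source) X :=
  h.tangent.mdifferentiableAt_source X

theorem mdifferentiableAt_zeroSection (q : Q) :
    MDifferentiableAt IQ IQ.tangent (zeroSection EQ (TangentSpace IQ : Q → Type _)) q :=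
  (contMDiff_zeroSection ℝ (TangentSpace IQ : Q → Type _) (n := ∞) q).mdifferentiableAt (by simp)

/-! ### The canonical involution exchanges the equations of `T(AG)` and `A(TG)` -/

/-- The base point in `TG` of the image of a vector of `T(AG)` under the canonical involution. -/
theorem canonicalInvolution_tangentMap_inclusion_proj (ξ : TangentBundle IA h.AlgebroidSpace) :
    (canonicalInvolution IG (tangentMap IA IG.tangent h.inclusion ξ)).1 =
      tangentMap IQ IG D.unit (tangentMap IA IQ (π AF (Algebroid h)) ξ) := by
  rw [← tangentMap_tangentBundle_proj, ← tangentMap_comp_at ξ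
    (mdifferentiableAt_tangentBundle_proj _) (h.mdifferentiableAt_inclusion _),
    ← tangentMap_comp_at ξ (h.mdifferentiableAt_unit _) (h.mdifferentiableAt_algebroid_proj _)]
  rfl

/-- Differentiate `Tα ∘ inclusion = 0 ∘ τ` and apply `κ`, which is natural for `α` and turns the
tangent map of the zero section of `TQ` into the zero section of `TTQ`. -/
theorem tangentMap_tangent_source_canonicalInvolution (ξ : TangentBundle IA h.AlgebroidSpace) :
    tangentMap IG.tangent IQ.tangent (tangentMap IG IQ D.source)
      (canonicalInvolution IG (tangentMap IA IG.tangent h.inclusion ξ)) =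
    zeroSection (EQ × EQ) (TangentSpace IQ.tangent) (tangentMap IA IQ (π AF (Algebroid h)) ξ) := by
  rw [← canonicalInvolution_tangentMap h.contMDiff_source,
    ← tangentMap_comp_at ξ (h.mdifferentiableAt_tangent_source _) (h.mdifferentiableAt_inclusion _),
    show tangentMap IG IQ D.source ∘ h.inclusion =
      zeroSection EQ (TangentSpace IQ) ∘ π AF (Algebroid h) from
      funext h.tangentMap_source_inclusion,
    tangentMap_comp_at ξ (mdifferentiableAt_zeroSection _) (h.mdifferentiableAt_algebroid_proj _),
    canonicalInvolution_tangentMap_zeroSection]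
  rfl

theorem exists_algebroid_tangent (ξ : TangentBundle IA h.AlgebroidSpace) :
    ∃ v : Algebroid h.tangent (tangentMap IA IQ (π AF (Algebroid h)) ξ),
      h.tangent.inclusion ⟨tangentMap IA IQ (π AF (Algebroid h)) ξ, v⟩ =
        canonicalInvolution IG (tangentMap IA IG.tangent h.inclusion ξ) :=
  h.tangent.exists_inclusion_eq (h.canonicalInvolution_tangentMap_inclusion_proj ξ)
    (h.tangentMap_tangent_source_canonicalInvolution ξ)

/-- A tangent vector of `TG` at a point of `AG` is determined by its images under the tangent maps of
the projection, of `Tα` and of the fibre coordinate. -/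
theorem ext_tangentBundle_tangentBundle {p : h.AlgebroidSpace} {a b : EG × EG}
    (h1 : tangentMap IG.tangent IG (π EG (TangentSpace IG)) ⟨h.inclusion p, a⟩ =
      tangentMap IG.tangent IG (π EG (TangentSpace IG)) ⟨h.inclusion p, b⟩)
    (h2 : tangentMap IG.tangent IQ.tangent (tangentMap IG IQ D.source) ⟨h.inclusion p, a⟩ =
      tangentMap IG.tangent IQ.tangent (tangentMap IG IQ D.source) ⟨h.inclusion p, b⟩)
    (h3 : tangentMap IG.tangent 𝓘(ℝ, AF) (h.fiberCoord p.1) ⟨h.inclusion p, a⟩ =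
      tangentMap IG.tangent 𝓘(ℝ, AF) (h.fiberCoord p.1) ⟨h.inclusion p, b⟩) : a = b := by
  obtain ⟨q, v⟩ := p
  set x : G := D.unit q
  set v' : EG := Algebroid.toTangent h q v
  have e1 : a.1 = b.1 := by
    rw [tangentMap_tangentBundle_proj, tangentMap_tangentBundle_proj] at h1
    exact eq_of_heq (TotalSpace.mk.inj h1).2
  -- By the first hypothesis `a` and `b` differ by a vertical vector `(0, d)`. The other two
  -- hypotheses are evaluated on the line `v' + t d` in the fibre, where `Tα` and the fibre
  -- coordinate are affine in `t`.
  set d : EG := a.2 - b.2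
  have hab : a - b = (0, d) := Prod.ext (sub_eq_zero.2 e1) rfl
  have hd := hasVelocity_vertical (I := IG) x v' d
  -- the `Tα` component
  have k1 : mfderiv IG.tangent IQ.tangent (tangentMap IG IQ D.source) (h.inclusion ⟨q, v⟩) (0, d) = 0 := by
    rw [← hab]
    refine (map_sub (mfderiv IG.tangent IQ.tangent (tangentMap IG IQ D.source) (h.inclusion ⟨q, v⟩))
      a b).trans (sub_eq_zero.2 ?_)
    exact eq_of_heq (TotalSpace.mk.inj h2).2
  have k2 := (hd.comp (h.mdifferentiableAt_tangent_source _))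
  have k3 := hasVelocity_vertical (I := IQ) (D.source x) (mfderiv IG IQ D.source x v')
    (mfderiv IG IQ D.source x d)
  have k4 := k2.unique (k3.congr (.of_forall fun t => by
    have : mfderiv IG IQ D.source x (v' + t • d) =
      mfderiv IG IQ D.source x v' + t • mfderiv IG IQ D.source x d := by
      refine (map_add (mfderiv IG IQ D.source x) v' (t • d)).trans ?_
      exact congrArg _ (map_smul (mfderiv IG IQ D.source x) t d)
    exact congrArg (fun e : EQ => (⟨D.source x, e⟩ : TangentBundle IQ Q)) this))
  have k5 : mfderiv IG IQ D.source x d = 0 := by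
    have k6 := eq_of_heq (TotalSpace.mk.inj k4).2
    have k7 := k1.symm.trans k6
    exact (congrArg (fun e : EQ × EQ => e.2) k7).symm
  -- the fibre coordinate
  have hL : MDifferentiableAt IG.tangent 𝓘(ℝ, AF) (h.fiberCoord q) (h.inclusion ⟨q, v⟩) :=
    ((h.contMDiffOn_fiberCoord q).contMDiffAt (((chartAt HG x).open_source.preimage
      (FiberBundle.continuous_proj EG (TangentSpace IG : G → Type _))).mem_nhds
      (mem_chart_source HG x))).mdifferentiableAt (by simp)
  have l1 : mfderiv IG.tangent 𝓘(ℝ, AF) (h.fiberCoord q) (h.inclusion ⟨q, v⟩) (0, d) = 0 := by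
    rw [← hab]
    refine (map_sub (mfderiv IG.tangent 𝓘(ℝ, AF) (h.fiberCoord q) (h.inclusion ⟨q, v⟩))
      a b).trans (sub_eq_zero.2 ?_)
    exact eq_of_heq (TotalSpace.mk.inj h3).2
  have l2 := (hd.comp hL).hasDerivAt
  have l3 : HasDerivAt (fun t : ℝ => h.compl q (v' + t • d)) (h.compl q d) 0 := by
    refine (h.compl q).hasFDerivAt.comp_hasDerivAt (0 : ℝ) ?_
    simpa using ((hasDerivAt_id (0 : ℝ)).smul_const d).const_add v'
  have hself : ∀ e : EG, h.chartDeriv q q e = e := fun e =>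
    DFunLike.congr_fun (mfderiv_extChartAt_self (I := IG) (x := D.unit q)) e
  have l4 := l2.unique (l3.congr_of_eventuallyEq (.of_forall fun t => by
    have := trivializationAt_tangent_snd (I := IG) (z := ⟨x, v' + t • d⟩) (mem_chart_source HG x)
    exact congrArg (h.compl q) (this.trans (hself _))))
  have l5 : h.compl q d = 0 := l4.symm.trans l1
  -- `d` is killed by `Tα`, so it lies in `A_q G`, where the injective coordinate `compl` vanishes
  -- on it.
  have m1 := h.vec_compl (h.mem_trivSet q) d k5
  rw [hself, l5] at m1
  have m2 : h.vec q q 0 = 0 := by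
    rw [vec]
    have : ((0 : EQ), (0 : AF)) = 0 := rfl
    rw [this, map_zero, map_zero]
  have m3 : d = 0 := m1.symm.trans m2
  exact Prod.ext e1 (sub_eq_zero.1 m3)

theorem mdifferentiableAt_retraction {q₀ : Q} {Z : TangentBundle IG G} (hZ : Z ∈ h.retractionSet q₀) :
    MDifferentiableAt IG.tangent IA (h.retraction q₀) Z :=
  ((h.contMDiffOn_retraction q₀).contMDiffAt ((h.isOpen_retractionSet q₀).mem_nhds hZ)).mdifferentiableAt
    (by simp)

include h in
theorem tangentMap_source_unit (w : TangentBundle IQ Q) :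
    tangentMap IG IQ D.source (tangentMap IQ IG D.unit w) = w :=
  tangentMap_eq_self_of_leftInv (h.mdifferentiableAt_source _) (h.mdifferentiableAt_unit _)
    (.of_forall h.source_unit)

/-- A tangent vector of `TG` at a point of `AG` that projects to `Tε w` and that `TTα` maps to the
zero vector over `w` is fixed by the tangent map of the local projection of `TG` onto `AG`. -/
theorem tangentMap_inclusion_retraction {p : h.AlgebroidSpace} {w : TangentBundle IQ Q}
    {ζ : TangentBundle IG.tangent (TangentBundle IG G)} (hp : ζ.1 = h.inclusion p)
    (h1 : tangentMap IG.tangent IG (π EG (TangentSpace IG)) ζ = tangentMap IQ IG D.unit w)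
    (h2 : tangentMap IG.tangent IQ.tangent (tangentMap IG IQ D.source) ζ =
      tangentMap IQ IQ.tangent (zeroSection EQ (TangentSpace IQ)) w) :
    tangentMap IA IG.tangent h.inclusion (tangentMap IG.tangent IA (h.retraction p.1) ζ) = ζ := by
  have hmem : ζ.1 ∈ h.retractionSet p.1 := by
    rw [hp]
    exact h.inclusion_mem_retractionSet (h.mem_trivSet p.1)
  have hnhds := (h.isOpen_retractionSet p.1).mem_nhds hmem
  have hr := h.mdifferentiableAt_retraction hmem
  have hi := h.mdifferentiableAt_inclusion (h.retraction p.1 ζ.1)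
  have hir : h.inclusion (h.retraction p.1 ζ.1) = ζ.1 := by
    rw [hp, h.retraction_inclusion (h.mem_trivSet p.1)]
  have hsp := (h.mdifferentiableAt_source ζ.1.1).comp ζ.1 (mdifferentiableAt_tangentBundle_proj ζ.1)
  have key : tangentMap IG.tangent IQ (D.source ∘ π EG (TangentSpace IG)) ζ = w := by
    rw [tangentMap_comp_at ζ (h.mdifferentiableAt_source _) (mdifferentiableAt_tangentBundle_proj _), h1,
      h.tangentMap_source_unit]
  rw [← tangentMap_comp_at ζ hi hr]
  have hf : MDifferentiableAt IG.tangent 𝓘(ℝ, AF) (h.fiberCoord p.1) ζ.1 :=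
    ((h.contMDiffOn_fiberCoord p.1).contMDiffAt (((chartAt HG (D.unit p.1)).open_source.preimage
      (FiberBundle.continuous_proj EG (TangentSpace IG : G → Type _))).mem_nhds
      hmem.1)).mdifferentiableAt (by simp)
  have hc := hi.comp ζ.1 hr
  -- Let `r` be the retraction, `i` the inclusion and `a = α ∘ π`. Near `ζ.1` one has `π ∘ i ∘ r = ε
  -- ∘ a`, `Tα ∘ i ∘ r = 0 ∘ a`, and the fibre coordinate is unchanged by `i ∘ r`. As `Ta ζ = w`,
  -- the vectors `ζ` and `T(i ∘ r) ζ` agree under the three maps that determine them.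
  have k1 : tangentMap IG.tangent IG (π EG (TangentSpace IG))
      (tangentMap IG.tangent IG.tangent (h.inclusion ∘ h.retraction p.1) ζ) =
      tangentMap IG.tangent IG (π EG (TangentSpace IG)) ζ := by
    rw [← tangentMap_comp_at ζ (mdifferentiableAt_tangentBundle_proj _) hc, h1]
    refine (Filter.EventuallyEq.tangentMap_eq (g := D.unit ∘ (D.source ∘ π EG (TangentSpace IG))) ?_).trans ?_
    · filter_upwards [hnhds] with Z hZ
      exact congrArg D.unit (h.retraction_proj hZ)
    · rw [tangentMap_comp_at ζ (h.mdifferentiableAt_unit _) hsp, key]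
  have k2 : tangentMap IG.tangent IQ.tangent (tangentMap IG IQ D.source)
      (tangentMap IG.tangent IG.tangent (h.inclusion ∘ h.retraction p.1) ζ) =
      tangentMap IG.tangent IQ.tangent (tangentMap IG IQ D.source) ζ := by
    rw [← tangentMap_comp_at ζ (h.mdifferentiableAt_tangent_source _) hc, h2]
    refine (Filter.EventuallyEq.tangentMap_eq
      (g := zeroSection EQ (TangentSpace IQ) ∘ (D.source ∘ π EG (TangentSpace IG))) ?_).trans ?_
    · filter_upwards [hnhds] with Z hZ
      exact (h.tangentMap_source_inclusion _).trans
        (congrArg (zeroSection EQ (TangentSpace IQ)) (h.retraction_proj hZ))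
    · rw [tangentMap_comp_at ζ (mdifferentiableAt_zeroSection _) hsp, key]
  have k3 : tangentMap IG.tangent 𝓘(ℝ, AF) (h.fiberCoord p.1)
      (tangentMap IG.tangent IG.tangent (h.inclusion ∘ h.retraction p.1) ζ) =
      tangentMap IG.tangent 𝓘(ℝ, AF) (h.fiberCoord p.1) ζ := by
    rw [← tangentMap_comp_at ζ (by rwa [Function.comp_apply, hir]) hc]
    refine Filter.EventuallyEq.tangentMap_eq ?_
    filter_upwards [hnhds] with Z hZ
    have : (h.retraction p.1 Z).1 ∈ h.trivSet p.1 := by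
      rw [h.retraction_proj hZ]
      exact hZ.2
    exact (h.fiberCoord_inclusion this).trans (congrArg Prod.snd (h.trivializationAt_retraction hZ))
  have hbase : (tangentMap IG.tangent IG.tangent (h.inclusion ∘ h.retraction p.1) ζ).1 =
    h.inclusion p := hir.trans hp
  generalize tangentMap IG.tangent IG.tangent (h.inclusion ∘ h.retraction p.1) ζ = ζ' at k1 k2 k3 hbase
  obtain ⟨_, a⟩ := ζ
  obtain ⟨_, b⟩ := ζ'
  dsimp only at hp hbase
  subst hp hbase
  exact congrArg _ (h.ext_tangentBundle_tangentBundle k1 k2 k3)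

/-- The local left inverse `retraction` differentiates to a left inverse on tangent vectors. -/
theorem tangentMap_inclusion_injective :
    Function.Injective (tangentMap IA IG.tangent h.inclusion) := by
  intro ξ ξ' hξ
  have h0 : ξ.1 = ξ'.1 := h.inclusion_injective (congrArg TotalSpace.proj hξ)
  have key : ∀ ζ : TangentBundle IA h.AlgebroidSpace, ζ.1 = ξ.1 →
      tangentMap IG.tangent IA (h.retraction ξ.1.1) (tangentMap IA IG.tangent h.inclusion ζ) = ζ := by
    intro ζ hζ
    have hm : ζ.1.1 ∈ h.trivSet ξ.1.1 := by
      rw [hζ]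
      exact h.mem_trivSet _
    refine tangentMap_eq_self_of_leftInv
      (h.mdifferentiableAt_retraction (h.inclusion_mem_retractionSet hm))
      (h.mdifferentiableAt_inclusion _) ?_
    filter_upwards [((h.isOpen_trivSet ξ.1.1).preimage
      (FiberBundle.continuous_proj AF (Algebroid h))).mem_nhds hm] with p hp
    exact h.retraction_inclusion hp
  rw [← key ξ rfl, hξ, key ξ' h0.symm]

theorem proj_canonicalInvolution_inclusion (η : h.tangent.AlgebroidSpace) :
    tangentMap IG.tangent IG (π EG (TangentSpace IG))
      (canonicalInvolution IG (h.tangent.inclusion η)) = tangentMap IQ IG D.unit η.1 := by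
  rw [tangentMap_tangentBundle_proj]
  rfl

/-- The equation `TTα = 0` of `A(TG)`, carried back through `κ`, becomes the differentiated equation
of `AG`. -/
theorem tangentMap_source_canonicalInvolution_inclusion (η : h.tangent.AlgebroidSpace) :
    tangentMap IG.tangent IQ.tangent (tangentMap IG IQ D.source)
      (canonicalInvolution IG (h.tangent.inclusion η)) =
      tangentMap IQ IQ.tangent (zeroSection EQ (TangentSpace IQ)) η.1 := by
  rw [← canonicalInvolution_tangentMap h.contMDiff_source,
    ← canonicalInvolution_canonicalInvolution
      (tangentMap IQ IQ.tangent (zeroSection EQ (TangentSpace IQ)) η.1),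
    canonicalInvolution_tangentMap_zeroSection]
  exact congrArg _ (h.tangent.tangentMap_source_inclusion η)

/-- Taking base points in the preceding equation shows that `Tα` kills the foot point of `κ η`,
which therefore lies in `AG`. -/
theorem exists_canonicalInvolution_inclusion_proj (η : h.tangent.AlgebroidSpace) :
    ∃ p : h.AlgebroidSpace, p.1 = η.1.1 ∧
      (canonicalInvolution IG (h.tangent.inclusion η)).1 = h.inclusion p := by
  obtain ⟨v, hv⟩ := h.exists_inclusion_eq
    (Z := (canonicalInvolution IG (h.tangent.inclusion η)).1) (q := η.1.1) rfl
    (congrArg TotalSpace.proj (h.tangentMap_source_canonicalInvolution_inclusion η))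
  exact ⟨_, rfl, hv.symm⟩

theorem tangentMap_inclusion_retraction_canonicalInvolution {q₀ : Q} (η : h.tangent.AlgebroidSpace)
    (hq : η.1.1 = q₀) :
    tangentMap IA IG.tangent h.inclusion (tangentMap IG.tangent IA (h.retraction q₀)
      (canonicalInvolution IG (h.tangent.inclusion η))) =
      canonicalInvolution IG (h.tangent.inclusion η) := by
  obtain ⟨p, hp, hp'⟩ := h.exists_canonicalInvolution_inclusion_proj η
  rw [← hq, ← hp]
  exact h.tangentMap_inclusion_retraction hp' (h.proj_canonicalInvolution_inclusion η)
    (h.tangentMap_source_canonicalInvolution_inclusion η)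

/-! ### The diffeomorphism from `T(AG)` to `A(TG)` -/

/-- The map `T(AG) → A(TG)` induced by the canonical involution. -/
noncomputable def toTangentAlgebroid (ξ : TangentBundle IA h.AlgebroidSpace) : h.tangent.AlgebroidSpace :=
  ⟨tangentMap IA IQ (π AF (Algebroid h)) ξ, (h.exists_algebroid_tangent ξ).choose⟩

theorem inclusion_toTangentAlgebroid (ξ : TangentBundle IA h.AlgebroidSpace) :
    h.tangent.inclusion (h.toTangentAlgebroid ξ) =
      canonicalInvolution IG (tangentMap IA IG.tangent h.inclusion ξ) :=
  (h.exists_algebroid_tangent ξ).choose_spec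

/-- Injectivity comes from that of the tangent map of the inclusion, as `κ` is an involution. A
preimage of `η` is the image of `κ η` under the tangent map of the retraction. -/
theorem toTangentAlgebroid_bijective : Function.Bijective h.toTangentAlgebroid := by
  constructor
  · intro ξ ξ' hξ
    have h1 := congrArg (fun η => canonicalInvolution IG (h.tangent.inclusion η)) hξ
    simp only [inclusion_toTangentAlgebroid, canonicalInvolution_canonicalInvolution] at h1
    exact h.tangentMap_inclusion_injective h1
  · intro η
    refine ⟨tangentMap IG.tangent IA (h.retraction η.1.1)
      (canonicalInvolution IG (h.tangent.inclusion η)), h.tangent.inclusion_injective ?_⟩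
    rw [h.inclusion_toTangentAlgebroid, h.tangentMap_inclusion_retraction_canonicalInvolution η rfl]
    rfl

theorem contMDiff_toTangentAlgebroid :
    ContMDiff (IA).tangent (IQ.tangent.prod 𝓘(ℝ, AlgebroidModelFiber (EG × EG) (EQ × EQ))) ∞
      h.toTangentAlgebroid := by
  intro ξ
  refine h.tangent.contMDiffAt_of_inclusion ?_ ?_
  · exact (contMDiff_proj (Algebroid h)).contMDiff_tangentMap (m := ∞) (n := ∞) (by simp) ξ
  · simp only [inclusion_toTangentAlgebroid]
    exact contMDiff_canonicalInvolution.comp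
      (h.contMDiff_inclusion.contMDiff_tangentMap (m := ∞) (by simp)) ξ

/-- The canonical isomorphism `T(AG) → A(TG)`. -/
noncomputable def tangentAlgebroidDiffeomorph :
    Diffeomorph (IA).tangent (IQ.tangent.prod 𝓘(ℝ, AlgebroidModelFiber (EG × EG) (EQ × EQ)))
      (TangentBundle IA h.AlgebroidSpace) h.tangent.AlgebroidSpace ∞ where
  toEquiv := Equiv.ofBijective h.toTangentAlgebroid h.toTangentAlgebroid_bijective
  contMDiff_toFun := h.contMDiff_toTangentAlgebroid
  contMDiff_invFun := by
    intro η₀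
    have hp : Continuous fun η : h.tangent.AlgebroidSpace => η.1.1 :=
      (FiberBundle.continuous_proj EQ (TangentSpace IQ : Q → Type _)).comp
        (FiberBundle.continuous_proj _ (Algebroid h.tangent))
    -- The formula for the inverse with the retraction centred at the fixed point `η₀.1.1`, so that
    -- it is smooth in `η`. It is valid for all `η` near `η₀`, since that retraction is a left
    -- inverse over all of `trivSet`.
    have h1 : ContMDiffAt (IQ.tangent.prod 𝓘(ℝ, AlgebroidModelFiber (EG × EG) (EQ × EQ))) (IA).tangent ∞
        (fun η => tangentMap IG.tangent IA (h.retraction η₀.1.1)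
          (canonicalInvolution IG (h.tangent.inclusion η))) η₀ := by
      have h2 := (h.contMDiffOn_retraction η₀.1.1).tangentMap_of_isOpen (h.isOpen_retractionSet _)
      have h3 := contMDiff_canonicalInvolution.comp h.tangent.contMDiff_inclusion
      refine (h2.contMDiffAt ?_).comp η₀ (h3 η₀)
      refine ((h.isOpen_retractionSet _).preimage (FiberBundle.continuous_proj _ _)).mem_nhds ?_
      obtain ⟨p, hp, hp'⟩ := h.exists_canonicalInvolution_inclusion_proj η₀
      change (canonicalInvolution IG (h.tangent.inclusion η₀)).1 ∈ h.retractionSet η₀.1.1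
      rw [hp']
      refine h.inclusion_mem_retractionSet ?_
      rw [hp]
      exact h.mem_trivSet _
    refine h1.congr_of_eventuallyEq ?_
    filter_upwards [((h.isOpen_trivSet η₀.1.1).preimage hp).mem_nhds (h.mem_trivSet _)] with η hη
    obtain ⟨ξ, rfl⟩ := h.toTangentAlgebroid_bijective.2 η
    rw [inclusion_toTangentAlgebroid, canonicalInvolution_canonicalInvolution]
    refine (Equiv.ofBijective_symm_apply_apply _ _ _).trans ?_
    have hm : ξ.1.1 ∈ h.trivSet η₀.1.1 := hη
    refine (tangentMap_eq_self_of_leftInv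
      (h.mdifferentiableAt_retraction (h.inclusion_mem_retractionSet hm))
      (h.mdifferentiableAt_inclusion _) ?_).symm
    filter_upwards [((h.isOpen_trivSet η₀.1.1).preimage
      (FiberBundle.continuous_proj AF (Algebroid h))).mem_nhds hm] with p hp
    exact h.retraction_inclusion hp

/-! ### Fibrewise operations on `AG` and linearity of the isomorphism -/

/-- Joint smoothness in the scalar and the vector is needed for the rays `t ↦ t v` and for the
two-parameter map `R (t c(s))`. -/
theorem contMDiff_smulMap_uncurry :
    ContMDiff (𝓘(ℝ, ℝ).prod IA) IA ∞ (fun x : ℝ × h.AlgebroidSpace => h.smulMap x.1 x.2) := by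
  rintro ⟨t, p⟩
  have h1 : ContMDiffAt (𝓘(ℝ, ℝ).prod IA) IQ ∞ (fun x : ℝ × h.AlgebroidSpace => x.2.1) (t, p) :=
    (contMDiffAt_proj (Algebroid h)).comp (t, p) contMDiffAt_snd
  rw [contMDiffAt_totalSpace]
  refine ⟨h1, ?_⟩
  have h2 := (contMDiffAt_totalSpace (n := ∞) (F := AF) (E := Algebroid h) (x₀ := (t, p))).1
    (contMDiffAt_snd (I := 𝓘(ℝ, ℝ)) (J := IA) (M := ℝ) (N := h.AlgebroidSpace))
  refine (ContMDiffAt.smul (contMDiffAt_fst (I := 𝓘(ℝ, ℝ)) (J := IA)) h2.2).congr_of_eventuallyEq ?_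
  filter_upwards [h1.continuousAt.preimage_mem_nhds
    ((h.isOpen_trivSet p.1).mem_nhds (h.mem_trivSet p.1))] with x hx
  exact ((trivializationAt AF (Algebroid h) p.1).linear ℝ hx).map_smul x.1 x.2.2

theorem contMDiff_smulMap (t : ℝ) : ContMDiff IA IA ∞ (h.smulMap t) :=
  h.contMDiff_smulMap_uncurry.comp (contMDiff_const.prodMk contMDiff_id)

local notation "IS" => ModelWithCorners.prod IQ 𝓘(ℝ, AlgebroidModelFiber EG EQ × AlgebroidModelFiber EG EQ)

theorem contMDiff_sumFst : ContMDiff IS IA ∞ h.sumFst := fun Ξ => by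
  have h1 := (contMDiffAt_totalSpace (IB := IQ) (n := ∞) (F := AF × AF) (E := Algebroid h ×ᵇ Algebroid h)
    (f := id) (x₀ := Ξ) (IM := IS)).1 contMDiffAt_id
  have h2 := ContMDiffAt.comp (I' := 𝓘(ℝ, AF × AF)) (g := Prod.fst) Ξ (contDiff_fst.contMDiff _) h1.2
  rw [contMDiffAt_totalSpace]
  exact ⟨h1.1, h2⟩

theorem contMDiff_sumSnd : ContMDiff IS IA ∞ h.sumSnd := fun Ξ => by
  have h1 := (contMDiffAt_totalSpace (IB := IQ) (n := ∞) (F := AF × AF) (E := Algebroid h ×ᵇ Algebroid h)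
    (f := id) (x₀ := Ξ) (IM := IS)).1 contMDiffAt_id
  have h2 := ContMDiffAt.comp (I' := 𝓘(ℝ, AF × AF)) (g := Prod.snd) Ξ (contDiff_snd.contMDiff _) h1.2
  rw [contMDiffAt_totalSpace]
  exact ⟨h1.1, h2⟩

theorem contMDiff_sumAdd : ContMDiff IS IA ∞ h.sumAdd := fun Ξ => by
  have h1 := (contMDiffAt_totalSpace (n := ∞) (F := AF) (E := Algebroid h)).1 (h.contMDiff_sumFst Ξ)
  have h2 := (contMDiffAt_totalSpace (n := ∞) (F := AF) (E := Algebroid h)).1 (h.contMDiff_sumSnd Ξ)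
  rw [contMDiffAt_totalSpace]
  refine ⟨h1.1, (h1.2.add h2.2).congr_of_eventuallyEq ?_⟩
  filter_upwards [h1.1.continuousAt.preimage_mem_nhds
    ((h.isOpen_trivSet Ξ.1).mem_nhds (h.mem_trivSet Ξ.1))] with x hx
  exact ((trivializationAt AF (Algebroid h) Ξ.1).linear ℝ hx).map_add x.2.1 x.2.2

include h in
theorem unit_injective : Function.Injective D.unit :=
  Function.LeftInverse.injective h.source_unit

theorem isFiberSum_of_inclusion {X Y Z : h.AlgebroidSpace}
    (hs : IsFiberSum (h.inclusion X) (h.inclusion Y) (h.inclusion Z)) : IsFiberSum X Y Z := by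
  obtain ⟨q, u⟩ := X
  obtain ⟨q', v⟩ := Y
  obtain ⟨g, a, b, e1, e2, e3⟩ := hs
  have h1 : D.unit q = g := congrArg TotalSpace.proj e1
  have h2 : q' = q := h.unit_injective ((congrArg TotalSpace.proj e2).trans h1.symm)
  subst h1 h2
  refine ⟨q', u, v, rfl, rfl, h.inclusion_injective (e3.trans ?_)⟩
  have k1 : Algebroid.toTangent h q' u = a := eq_of_heq (TotalSpace.mk.inj e1).2
  have k2 : Algebroid.toTangent h q' v = b := eq_of_heq (TotalSpace.mk.inj e2).2
  rw [← k1, ← k2, ← map_add]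
  rfl

theorem inclusion_smulMap (t : ℝ) (p : h.AlgebroidSpace) :
    h.inclusion (h.smulMap t p) = ⟨(h.inclusion p).1, t • (h.inclusion p).2⟩ :=
  congrArg (TotalSpace.mk (D.unit p.1)) (map_smul (Algebroid.toTangent h p.1) t p.2)

theorem eq_smulMap_of_inclusion {X Y : h.AlgebroidSpace} {Z : TangentBundle IG G} {t : ℝ}
    (hX : h.inclusion X = Z) (hY : h.inclusion Y = ⟨Z.1, t • Z.2⟩) : Y = h.smulMap t X := by
  subst hX
  exact h.inclusion_injective (hY.trans (h.inclusion_smulMap t X).symm)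

/-- A tangent vector of `AG ⊕ AG` is the velocity of a curve there. The images in `TG` of its two
projections and of its sum form a fibrewise sum at each time, and `HasVelocity.isFiberSum` turns
this into a sum in `A(TG)` after applying `κ`. Scalars are treated alike with
`HasVelocity.fiber_smul`. -/
theorem isCanonicalAlgebroidIso_toTangentAlgebroid :
    h.IsCanonicalAlgebroidIso h.tangent h.toTangentAlgebroid where
  inclusion_apply := h.inclusion_toTangentAlgebroid
  proj_apply _ := rfl
  map_add Ξ := by
    obtain ⟨c, -, hc⟩ := exists_hasVelocity (n := ∞) Ξ
    have hi := h.mdifferentiableAt_inclusion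
    have h1 := (hc.comp ((h.contMDiff_sumFst _).mdifferentiableAt (by simp))).comp (hi _)
    have h2 := (hc.comp ((h.contMDiff_sumSnd _).mdifferentiableAt (by simp))).comp (hi _)
    have h3 := (hc.comp ((h.contMDiff_sumAdd _).mdifferentiableAt (by simp))).comp (hi _)
    have h4 := h1.isFiberSum h2 h3 (.of_forall fun t =>
      ⟨D.unit (c t).1, Algebroid.toTangent h _ (c t).2.1, Algebroid.toTangent h _ (c t).2.2, rfl, rfl,
        congrArg (TotalSpace.mk (D.unit (c t).1))
          (map_add (Algebroid.toTangent h (c t).1) (c t).2.1 (c t).2.2)⟩)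
    simp only [← inclusion_toTangentAlgebroid] at h4
    exact h.tangent.isFiberSum_of_inclusion h4
  map_smul t ξ := by
    obtain ⟨c, -, hc⟩ := exists_hasVelocity (n := ∞) ξ
    have hi := h.mdifferentiableAt_inclusion
    have h1 := hc.comp (hi _)
    have h2 := (hc.comp ((h.contMDiff_smulMap t _).mdifferentiableAt (by simp))).comp (hi _)
    have h4 := h1.fiber_smul h2 fun s => h.inclusion_smulMap t (c s)
    exact h.tangent.eq_smulMap_of_inclusion (h.inclusion_toTangentAlgebroid ξ)
      ((h.inclusion_toTangentAlgebroid _).trans h4)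

/-! ### The tangent map of a generalized discretization map -/

theorem hasVelocity_verticalLift (q : Q) (v : Algebroid h q) :
    HasVelocity IA (fun t : ℝ => (⟨q, t • v⟩ : h.AlgebroidSpace)) ⟨⟨q, 0⟩, h.verticalLift q v⟩ := by
  have h1 : MDifferentiableAt 𝓘(ℝ, ℝ) IA (fun t : ℝ => (⟨q, t • v⟩ : h.AlgebroidSpace)) 0 :=
    ((h.contMDiff_smulMap_uncurry.comp
      (contMDiff_id.prodMk (contMDiff_const (c := (⟨q, v⟩ : h.AlgebroidSpace)))) :
      ContMDiff 𝓘(ℝ, ℝ) IA ∞ _) 0).mdifferentiableAt (by simp)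
  have h2 : ∀ (y y' : h.AlgebroidSpace) (w : EQ × AF), y = y' →
      (⟨y, w⟩ : TangentBundle IA h.AlgebroidSpace) = ⟨y', w⟩ := by
    rintro y _ w rfl
    rfl
  exact (congrArg (HasVelocity IA _) (h2 _ _ _ (by rw [zero_smul]))).mp h1.hasVelocity

theorem hasVelocity_verticalDeriv {R : h.AlgebroidSpace → G} (hR : ContMDiff IA IG ∞ R)
    (h0 : ∀ q, R ⟨q, 0⟩ = D.unit q) (q : Q) (v : Algebroid h q) :
    HasVelocity IG (fun t : ℝ => R ⟨q, t • v⟩)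
      ⟨D.unit q, (show TangentSpace IG (D.unit q) from h.verticalDeriv R q v)⟩ := by
  have h1 := (h.hasVelocity_verticalLift q v).comp (f := R) ((hR _).mdifferentiableAt (by simp))
  have h2 : ∀ (y y' : G) (w : EG), y = y' → (⟨y, w⟩ : TangentBundle IG G) = ⟨y', w⟩ := by
    rintro y _ w rfl
    rfl
  exact (congrArg (HasVelocity IG _) (h2 _ _ _ (h0 q))).mp h1

/-- The condition on the derivative of a generalized discretization map, in terms of velocities of
curves. -/
theorem verticalDeriv_eq_iff {R : h.AlgebroidSpace → G} (hR : ContMDiff IA IG ∞ R)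
    (h0 : ∀ q, R ⟨q, 0⟩ = D.unit q) {q : Q} {v : Algebroid h q} {V : TangentBundle IG G}
    (hV : HasVelocity IG (fun t : ℝ => R ⟨q, t • v⟩) V) :
    (show TangentSpace IG (D.unit q) from h.verticalDeriv R q v) =
      Algebroid.toTangent h q v +
        mfderiv IQ IG D.unit q (mfderiv IG IQ D.source (D.unit q) (h.verticalDeriv R q v)) ↔
    IsFiberSum (h.inclusion ⟨q, v⟩) (tangentMap IQ IG D.unit (tangentMap IG IQ D.source V)) V := by
  rw [hV.unique (h.hasVelocity_verticalDeriv hR h0 q v)]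
  set d : EG := h.verticalDeriv R q v
  have h2 : ∀ (y y' : Q) (w : EQ), y = y' → (⟨y, w⟩ : TangentBundle IQ Q) = ⟨y', w⟩ := by
    rintro y _ w rfl
    rfl
  have h3 : tangentMap IQ IG D.unit (tangentMap IG IQ D.source ⟨D.unit q, d⟩) =
      ⟨D.unit q, mfderiv IQ IG D.unit q (mfderiv IG IQ D.source (D.unit q) d)⟩ :=
    congrArg (tangentMap IQ IG D.unit) (h2 _ _ _ (h.source_unit q))
  have h4 : IsFiberSum (h.inclusion ⟨q, v⟩)
      (tangentMap IQ IG D.unit (tangentMap IG IQ D.source ⟨D.unit q, d⟩)) ⟨D.unit q, d⟩ ↔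
      IsFiberSum (⟨D.unit q, Algebroid.toTangent h q v⟩ : TangentBundle IG G)
        ⟨D.unit q, mfderiv IQ IG D.unit q (mfderiv IG IQ D.source (D.unit q) d)⟩ ⟨D.unit q, d⟩ := by
    rw [h3]
    rfl
  refine Iff.trans ?_ h4.symm
  constructor
  · intro hd
    exact ⟨_, _, _, rfl, rfl, congrArg (fun e : EG => (⟨D.unit q, e⟩ : TangentBundle IG G)) hd⟩
  · rintro ⟨x, a, b, e1, e2, e3⟩
    obtain ⟨rfl, k1⟩ := TotalSpace.mk.inj e1
    have k2 := eq_of_heq (TotalSpace.mk.inj e2).2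
    have k3 := eq_of_heq (TotalSpace.mk.inj e3).2
    rw [← eq_of_heq k1, ← k2] at k3
    exact k3

/-- Homogeneity of `J` rewrites `TR ∘ J⁻¹` on the ray through `η` as the tangent map of `R (t ·)` at
the single vector `ξ`. The case `t = 0` gives the values on the zero section, and varying `t` gives
the vertical derivative. -/
theorem tangentMap_tangentAlgebroidDiffeomorph_symm_smulMap {R : h.AlgebroidSpace → G}
    (hR : ContMDiff IA IG ∞ R) (t : ℝ) {ξ : TangentBundle IA h.AlgebroidSpace}
    {η : h.tangent.AlgebroidSpace} (hη : h.toTangentAlgebroid ξ = η) :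
    tangentMap IA IG R (h.tangentAlgebroidDiffeomorph.symm (h.tangent.smulMap t η)) =
      tangentMap IA IG (R ∘ h.smulMap t) ξ := by
  subst hη
  have h1 : h.tangentAlgebroidDiffeomorph (tangentMap IA IA (h.smulMap t) ξ) =
    h.tangent.smulMap t (h.toTangentAlgebroid ξ) :=
    h.isCanonicalAlgebroidIso_toTangentAlgebroid.map_smul t ξ
  rw [← h1, Diffeomorph.symm_apply_apply, tangentMap_comp_at ξ ((hR _).mdifferentiableAt (by simp))
      ((h.contMDiff_smulMap t _).mdifferentiableAt (by simp))]

theorem IsGeneralizedDiscretizationMap.tangent {R : h.AlgebroidSpace → G}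
    (hR : h.IsGeneralizedDiscretizationMap R) :
    h.tangent.IsGeneralizedDiscretizationMap
      (tangentMap IA IG R ∘ h.tangentAlgebroidDiffeomorph.symm) := by
  have hsm := (hR.contMDiff.contMDiff_tangentMap (m := ∞) (by simp)).comp
    h.tangentAlgebroidDiffeomorph.symm.contMDiff
  have hzero : ∀ w : TangentBundle IQ Q, (tangentMap IA IG R ∘ h.tangentAlgebroidDiffeomorph.symm)
      (⟨w, 0⟩ : h.tangent.AlgebroidSpace) = tangentMap IQ IG D.unit w := by
    intro w
    obtain ⟨ξ, hξ⟩ := h.toTangentAlgebroid_bijective.2 (⟨w, 0⟩ : h.tangent.AlgebroidSpace)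
    have h1 := h.tangentMap_tangentAlgebroidDiffeomorph_symm_smulMap hR.contMDiff 0 hξ
    have h2 : h.tangent.smulMap 0 (⟨w, 0⟩ : h.tangent.AlgebroidSpace) = ⟨w, 0⟩ := by
      rw [smulMap, smul_zero]
    -- Multiplication by `0` followed by `R` is `ε ∘ τ`, whose tangent map is `Tε ∘ Tτ`.
    have h3 : R ∘ h.smulMap 0 = D.unit ∘ π AF (Algebroid h) := by
      funext p
      simp only [Function.comp_apply, smulMap, zero_smul, hR.map_zero]
    rw [h2, h3, tangentMap_comp_at _ (h.mdifferentiableAt_unit _)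
      (h.mdifferentiableAt_algebroid_proj _)] at h1
    exact h1.trans (congrArg _ (congrArg TotalSpace.proj hξ))
  refine ⟨hsm, hzero, fun w U => ?_⟩
  have hζ := h.tangent.hasVelocity_verticalDeriv hsm hzero w U
  refine (h.tangent.verticalDeriv_eq_iff hsm hzero hζ).2 ?_
  generalize (⟨_, _⟩ : TangentBundle IG.tangent (TangentBundle IG G)) = ζ at hζ
  obtain ⟨ξ, hξ⟩ := h.toTangentAlgebroid_bijective.2 (⟨w, U⟩ : h.tangent.AlgebroidSpace)
  obtain ⟨c, hcs, hc⟩ := exists_hasVelocity (n := ∞) ξ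
  let f : ℝ × ℝ → G := fun x => R (h.smulMap x.1 (c x.2))
  have hf : ∀ x : ℝ × ℝ, ContMDiffAt 𝓘(ℝ, ℝ) IA ∞ c x.2 → ContMDiffAt 𝓘(ℝ, ℝ × ℝ) IG ∞ f x := by
    intro x hx
    have h1 : ContMDiffAt 𝓘(ℝ, ℝ × ℝ) (𝓘(ℝ, ℝ).prod IA) ∞ (fun x : ℝ × ℝ => (x.1, c x.2)) x :=
      (contDiff_fst.contMDiff x).prodMk (hx.comp x (contDiff_snd.contMDiff x))
    exact (hR.contMDiff _).comp x ((h.contMDiff_smulMap_uncurry (x.1, c x.2)).comp x h1)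
  have hf0 : ContMDiffAt 𝓘(ℝ, ℝ × ℝ) IG ∞ f 0 := hf 0 hcs
  have hf2 : ContMDiffAt 𝓘(ℝ, ℝ × ℝ) IG 2 f 0 := hf0.of_le ENat.LEInfty.out
  -- `∂ₛ f (t, 0)` is the value of `TR ∘ J⁻¹` at `t U`, so `ζ` is the mixed derivative `∂ₜ∂ₛ f` at
  -- the origin and `κ ζ` is the velocity of `s ↦ ∂ₜ f (0, s)`.
  have hsweep : ∀ t, sweep IG f (1, 0) (0, 1) t =
      (tangentMap IA IG R ∘ h.tangentAlgebroidDiffeomorph.symm) ⟨w, t • U⟩ := by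
    intro t
    have h1 := h.tangentMap_tangentAlgebroidDiffeomorph_symm_smulMap hR.contMDiff t hξ
    refine Eq.trans ?_ h1.symm
    refine HasVelocity.unique (c := fun s => f (t, s)) ?_
      (hc.comp ((hR.contMDiff.comp (h.contMDiff_smulMap t) _).mdifferentiableAt (by simp)))
    have h2 : HasVelocity 𝓘(ℝ, ℝ × ℝ) (fun s : ℝ => (t, s)) ⟨(t, 0), ((0, 1) : ℝ × ℝ)⟩ :=
      hasVelocity_of_hasDerivAt ((hasDerivAt_const 0 t).prodMk (hasDerivAt_id 0))
    have h3 : t • ((1, 0) : ℝ × ℝ) = (t, 0) := by simp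
    rw [sweep, h3]
    exact h2.comp (f := f) ((hf (t, 0) hcs).mdifferentiableAt (by simp))
  have hV : HasVelocity IG.tangent (sweep IG f (1, 0) (0, 1)) ζ :=
    hζ.congr (.of_forall hsweep)
  have hV' := hV.sweep_swap hf2
  -- The hypothesis on `R` at the vector `c s`. The curve is only known to be smooth at `0`, so
  -- differentiability of `f` at `(0, s)` is obtained for small `s` from its being `C¹` at the
  -- origin.
  have hsum : ∀ᶠ s in 𝓝 (0 : ℝ), IsFiberSum (h.inclusion (c s))
      (tangentMap IQ IG D.unit (tangentMap IG IQ D.source (sweep IG f (0, 1) (1, 0) s)))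
      (sweep IG f (0, 1) (1, 0) s) := by
    have h1 : Filter.Tendsto (fun s : ℝ => s • ((0, 1) : ℝ × ℝ)) (𝓝 0) (𝓝 0) := by
      have : Continuous (fun s : ℝ => s • ((0, 1) : ℝ × ℝ)) := by fun_prop
      simpa using this.tendsto 0
    filter_upwards [h1.eventually
      (hf0.of_le (by simp : (1 : WithTop ℕ∞) ≤ ∞)).eventually_mdifferentiableAt] with s hs
    have h2 : HasVelocity 𝓘(ℝ, ℝ × ℝ) (fun t : ℝ => (t, s)) ⟨(0, s), ((1, 0) : ℝ × ℝ)⟩ :=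
      hasVelocity_of_hasDerivAt ((hasDerivAt_id 0).prodMk (hasDerivAt_const 0 s))
    have h3 : s • ((0, 1) : ℝ × ℝ) = (0, s) := by simp
    rw [h3] at hs
    have h4 : HasVelocity IG (fun t : ℝ => R ⟨(c s).1, t • (c s).2⟩) (sweep IG f (0, 1) (1, 0) s) := by
      rw [sweep, h3]
      exact h2.comp (f := f) hs
    exact (h.verticalDeriv_eq_iff hR.contMDiff hR.map_zero h4).1 (hR.map_verticalLift _ _)
  -- The `s`-derivative of that identity, with `κ` applied to each of the three velocities; the last
  -- of them becomes `κ (κ ζ) = ζ`.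
  have hfs := (hc.comp (h.mdifferentiableAt_inclusion _)).isFiberSum
    ((hV'.comp (h.mdifferentiableAt_tangent_source _)).comp
      (h.tangent.mdifferentiableAt_unit _)) hV' hsum
  rw [← h.inclusion_toTangentAlgebroid, hξ] at hfs
  -- Naturality of `κ` for `α` and `ε` cancels the two involutions around `TTε ∘ TTα`.
  have h5 : canonicalInvolution IG (tangentMap IQ.tangent IG.tangent (tangentMap IQ IG D.unit)
      (tangentMap IG.tangent IQ.tangent (tangentMap IG IQ D.source) (canonicalInvolution IG ζ))) =
      tangentMap IQ.tangent IG.tangent (tangentMap IQ IG D.unit)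
        (tangentMap IG.tangent IQ.tangent (tangentMap IG IQ D.source) ζ) := by
    rw [← canonicalInvolution_tangentMap h.contMDiff_source,
      canonicalInvolution_tangentMap h.contMDiff_unit, canonicalInvolution_canonicalInvolution]
  have h6 := h5 ▸ hfs
  exact h6

end GroupoidData.IsLieGroupoid

theorem mainTheorem4
    {EG HG G EQ HQ Q : Type*}
    [NormedAddCommGroup EG] [NormedSpace ℝ EG] [FiniteDimensional ℝ EG] [TopologicalSpace HG]
    [NormedAddCommGroup EQ] [NormedSpace ℝ EQ] [FiniteDimensional ℝ EQ] [TopologicalSpace HQ]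
    {IG : ModelWithCorners ℝ EG HG} [IG.Boundaryless]
    {IQ : ModelWithCorners ℝ EQ HQ} [IQ.Boundaryless]
    [TopologicalSpace G] [ChartedSpace HG G] [IsManifold IG ∞ G]
    [TopologicalSpace Q] [ChartedSpace HQ Q] [IsManifold IQ ∞ Q]
    (D : GroupoidData G Q) (hD : D.IsLieGroupoid IG IQ)
    (R : hD.AlgebroidSpace → G) (hR : hD.IsGeneralizedDiscretizationMap R) :
    ∃ (hT : (D.tangent IG IQ).IsLieGroupoid IG.tangent IQ.tangent)
      (J : Diffeomorph (IQ.prod 𝓘(ℝ, AlgebroidModelFiber EG EQ)).tangent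
        (IQ.tangent.prod 𝓘(ℝ, AlgebroidModelFiber (EG × EG) (EQ × EQ)))
        (TangentBundle (IQ.prod 𝓘(ℝ, AlgebroidModelFiber EG EQ)) hD.AlgebroidSpace)
        hT.AlgebroidSpace ∞),
      hD.IsCanonicalAlgebroidIso hT J ∧
      hT.IsGeneralizedDiscretizationMap
        (tangentMap (IQ.prod 𝓘(ℝ, AlgebroidModelFiber EG EQ)) IG R ∘ J.symm) :=
  ⟨hD.tangent, hD.tangentAlgebroidDiffeomorph, hD.isCanonicalAlgebroidIso_toTangentAlgebroid,
    hR.tangent⟩
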